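/- **Notation.** For a positive semidefinite $M\in\mathbb R^{s\times s}$ let $\Phi_s(a;M)$ be the distribution function at $a$ of the centred Gaussian with covariance $M$ ($\Phi_0=1$), $\Phi=\Phi_1(\cdot\,;1)$ (with $\Phi(-\infty)=0$, $\Phi(+\infty)=1$), and let $\phi_p(\cdot\,;\Omega)$ be the centred Gaussian density with covariance $\Omega$. For $\Omega$ with positive diagonal let $D_\Omega$ be the diagonal matrix of the square roots of the diagonal entries of $\Omega$, and $\bar\Omega=D_\Omega^{-1}\Omega D_\Omega^{-1}$. The law $\mathrm{SUN}_{p,s}(\xi,\Omega,\Delta,\gamma,\Gamma)$ on $\mathbb R^p$ has density $$z\mapsto \phi_p(z-\xi;\Omega)\,\frac{\Phi_s\big(\gamma+\Delta^T\bar\Omega^{-1}D_\Omega^{-1}(z-\xi);\,\Gamma-\Delta^T\bar\Omega^{-1}\Delta\big)}{\Phi_s(\gamma;\Gamma)} .$$ Given $\xi:\mathbb R^d\to\mathbb R$, $\Omega:\mathbb R^d\times\mathbb R^d\to\mathbb R$, $\Delta:\mathbb R^d\to\mathbb R^s$, $\gamma\in\mathbb R^s$, $\Gamma\in\mathbb R^{s\times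 s}$, a random function $f:\mathbb R^d\to\mathbb R$ is a $\mathrm{SkewGP}_s(\xi,\Omega,\Delta,\gamma,\Gamma)$ if for all distinct $x_1,\dots,x_n$, with $X'=(x_1,\dots,x_n)$, $\xi(X')=(\xi(x_i))_i$, $\Omega(X',X')=(\Omega(x_i,x_j))_{ij}$ and $\Delta(X')\in\mathbb R^{n\times s}$ the matrix with rows $\Delta(x_i)^T$, the matrix $M=\begin{bmatrix}\Gamma&\Delta(X')^T\\ \Delta(X')&\bar\Omega(X',X')\end{bmatrix}$ is positive definite and $f(X')=(f(x_1),\dots,f(x_n))\sim\mathrm{SUN}_{n,s}(\xi(X'),\Omega(X',X'),\Delta(X'),\gamma,\Gamma)$. It is a boundary SkewGP if the marginals are as above but only $\Omega(X',X')$ is required to be positive definite, $M$ positive semidefinite and $\Phi_s(\gamma;\Gamma)>0$. The posterior law of $f$ under a likelihood $L(f)$ is the prior law multiplied by $L$ and normalized. **Theorem.** Let $f\sim\mathrm{SkewGP}_s(\xi,\Omega,\Delta,\gamma,\Gamma)$ and let $X=(x_1,\dots,x_n)$ be points of $\mathbb R^d$. (1) Let $W\in\mathbb R^{m_a\times n}$,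 $Z\in\mathbb R^{m_a}$ and $\Sigma\in\mathbb R^{m_a\times m_a}$ symmetric positive definite. Under the affine probit likelihood $\Phi_{m_a}(Z+Wf(X);\Sigma)$ the marginal likelihood is positive and the posterior of $f$ is a $\mathrm{SkewGP}_{s+m_a}(\xi,\Omega,\tilde\Delta,\gamma_p,\Gamma_p)$ with $$\tilde\Delta(x)=\big[\Delta(x),\;D_{\Omega(x,x)}^{-1}\Omega(x,X)W^T\big],\qquad \gamma_p=[\gamma,\;Z+W\xi(X)],$$ $$\Gamma_p=\begin{bmatrix}\Gamma&\Delta(X)^TD_{\Omega(X,X)}W^T\\ WD_{\Omega(X,X)}\Delta(X)&W\Omega(X,X)W^T+\Sigma\end{bmatrix}.$$ (2) For the classification likelihood $\prod_{i}\Phi(y_if(x_i))$, $y_i\in\{-1,1\}$, the posterior of $f$ is the SkewGP of (1) with $W=\mathrm{diag}(y_1,\dots,y_n)$, $Z=0$, $\Sigma=I$. (3) For the preference likelihood $\prod_{k=1}^{m_a}\Phi\big((f(x_{v_k})-f(x_{u_k}))/(\sqrt2\,\sigma_v)\big)$, $\sigma_v>0$, the posterior of $f$ is the SkewGP of (1)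 with $W_{kj}=(\mathbf 1[v_k=j]-\mathbf 1[u_k=j])/(\sqrt2\,\sigma_v)$, $Z=0$, $\Sigma=I$. (4) Let $-\infty=b_0<b_1<\dots<b_r=\infty$, $\sigma_v>0$ and $y_i\in\{1,\dots,r\}$. For the ordinal likelihood $\prod_{i}\big[\Phi\big(\tfrac{b_{y_i}-f(x_i)}{\sigma_v}\big)-\Phi\big(\tfrac{b_{y_i-1}-f(x_i)}{\sigma_v}\big)\big]$ the posterior of $f$ is a boundary SkewGP with mean $\xi$, scale $\Omega$ and $\tilde\Delta,\gamma_p,\Gamma_p$ as in (1), where there is one coordinate $p$ for each finite cut point $c_p$ bounding the category of an observation $i_p$, with sign $\epsilon_p=1$ for an upper and $\epsilon_p=-1$ for a lower cut point, and $W_{pj}=-\epsilon_p\mathbf 1[i_p=j]/\sigma_v$, $Z_p=\epsilon_pc_p/\sigma_v$, $\Sigma_{pq}=\epsilon_p\epsilon_q\mathbf 1[i_p=i_q]$ (positive semidefinite). If every observed category is unbounded on at least one side, it is a SkewGP. -/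

import Mathlib

open MeasureTheory ProbabilityTheory
open scoped ENNReal Matrix

namespace SkewGP

/-! ### Gaussian densities and distribution functions -/

section Gaussian

variable {ι : Type*} [Fintype ι] [DecidableEq ι]

/-- `φ_p(z; Ω)`: the density at `z` of the centred Gaussian with (positive definite)
covariance matrix `Ω`. -/
noncomputable def gaussPDF (Ω : Matrix ι ι ℝ) (z : ι → ℝ) : ℝ :=
  (Real.sqrt ((2 * Real.pi) ^ Fintype.card ι * Ω.det))⁻¹ * Real.exp (-(z ⬝ᵥ (Ω⁻¹ *ᵥ z)) / 2)

/-- `Φ_s(a; M)`: the cumulative distribution function at `a` of the centred Gaussian with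
(positive semidefinite) covariance matrix `M`. It equals `1` when `s = 0`. -/
noncomputable def gaussCDF (M : Matrix ι ι ℝ) (a : ι → ℝ) : ℝ :=
  (multivariateGaussian (0 : EuclideanSpace ℝ ι) M).real {z | ∀ i, z i ≤ a i}

end Gaussian

/-! ### The unified skew-normal distribution -/

section SUN

variable {ι σ : Type*} [Fintype ι] [DecidableEq ι] [Fintype σ] [DecidableEq σ]

/-- `D_Ω`: the diagonal matrix of the square roots of the diagonal entries of `Ω`. -/
noncomputable def stdDev (Ω : Matrix ι ι ℝ) : Matrix ι ι ℝ :=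
  Matrix.diagonal fun i => Real.sqrt (Ω i i)

/-- The correlation matrix `Ω̄` with `Ω = D_Ω Ω̄ D_Ω`. -/
noncomputable def corr (Ω : Matrix ι ι ℝ) : Matrix ι ι ℝ :=
  (stdDev Ω)⁻¹ * Ω * (stdDev Ω)⁻¹

/-- The matrix `M = [Γ, Δᵀ; Δ, Ω̄]`. -/
noncomputable def jointMatrix (Ω : Matrix ι ι ℝ) (Δ : Matrix ι σ ℝ) (Γ : Matrix σ σ ℝ) :
    Matrix (σ ⊕ ι) (σ ⊕ ι) ℝ :=
  Matrix.fromBlocks Γ Δᵀ Δ (corr Ω)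

/-- The density of `SUN_{p,s}(ξ, Ω, Δ, γ, Γ)`. -/
noncomputable def sunPDF (ξ : ι → ℝ) (Ω : Matrix ι ι ℝ) (Δ : Matrix ι σ ℝ)
    (γ : σ → ℝ) (Γ : Matrix σ σ ℝ) (z : ι → ℝ) : ℝ :=
  gaussPDF Ω (z - ξ) *
    (gaussCDF (Γ - Δᵀ * (corr Ω)⁻¹ * Δ)
        (γ + (Δᵀ * (corr Ω)⁻¹ * (stdDev Ω)⁻¹) *ᵥ (z - ξ)) /
      gaussCDF Γ γ)

/-- The law `SUN_{p,s}(ξ, Ω, Δ, γ, Γ)` on `ℝ^p`. -/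
noncomputable def sunMeasure (ξ : ι → ℝ) (Ω : Matrix ι ι ℝ) (Δ : Matrix ι σ ℝ)
    (γ : σ → ℝ) (Γ : Matrix σ σ ℝ) : Measure (ι → ℝ) :=
  volume.withDensity fun z => ENNReal.ofReal (sunPDF ξ Ω Δ γ Γ z)

end SUN

/-! ### Skew Gaussian processes, as laws on the space of functions `E → ℝ` -/

section Processes

variable {E σ : Type*} [Fintype σ] [DecidableEq σ]

/-- `Ω(X, X)`. -/
def scaleMatrix {ι : Type*} (K : E → E → ℝ) (x : ι → E) : Matrix ι ι ℝ :=
  Matrix.of fun i j => K (x i) (x j)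

/-- `Δ(X)`, with one row for each point. -/
def skewMatrix {ι : Type*} (Δ : E → σ → ℝ) (x : ι → E) : Matrix ι σ ℝ :=
  Matrix.of fun i k => Δ (x i) k

/-- All finite-dimensional marginals of `μ` (at distinct points) are
`SUN(ξ(X), Ω(X,X), Δ(X), γ, Γ)`. -/
def HasSUNMarginals (μ : Measure (E → ℝ)) (ξ : E → ℝ) (K : E → E → ℝ) (Δ : E → σ → ℝ)
    (γ : σ → ℝ) (Γ : Matrix σ σ ℝ) : Prop :=
  ∀ (n : ℕ) (x : Fin n → E), Function.Injective x →
    μ.map (fun f i => f (x i)) =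
      sunMeasure (fun i => ξ (x i)) (scaleMatrix K x) (skewMatrix Δ x) γ Γ

/-- `μ` is the law of a `SkewGP(ξ, K, Δ, γ, Γ)`: the matrix `M` is positive definite at every
finite family of distinct points, and all finite-dimensional marginals are SUN. -/
structure IsSkewGP (μ : Measure (E → ℝ)) (ξ : E → ℝ) (K : E → E → ℝ) (Δ : E → σ → ℝ)
    (γ : σ → ℝ) (Γ : Matrix σ σ ℝ) : Prop where
  posDef : ∀ (n : ℕ) (x : Fin n → E), Function.Injective x →
    (jointMatrix (scaleMatrix K x) (skewMatrix Δ x) Γ).PosDef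
  marginals : HasSUNMarginals μ ξ K Δ γ Γ

/-- The boundary case of `IsSkewGP`: the matrices `Ω(X,X)` are still positive definite, but `M`
may be singular; the SUN densities make sense as long as `Φ_s(γ; Γ) > 0`. -/
structure IsBoundarySkewGP (μ : Measure (E → ℝ)) (ξ : E → ℝ) (K : E → E → ℝ)
    (Δ : E → σ → ℝ) (γ : σ → ℝ) (Γ : Matrix σ σ ℝ) : Prop where
  scale_posDef : ∀ (n : ℕ) (x : Fin n → E), Function.Injective x → (scaleMatrix K x).PosDef
  posSemidef : ∀ (n : ℕ) (x : Fin n → E), Function.Injective x →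
    (jointMatrix (scaleMatrix K x) (skewMatrix Δ x) Γ).PosSemidef
  normalizer_pos : 0 < gaussCDF Γ γ
  marginals : HasSUNMarginals μ ξ K Δ γ Γ

end Processes

/-! ### Bayes' rule -/

section Bayes

variable {F : Type*} [MeasurableSpace F]

/-- The marginal likelihood of the data under the prior `μ` and the likelihood `L`. -/
noncomputable def evidence (μ : Measure F) (L : F → ℝ) : ℝ≥0∞ :=
  ∫⁻ f, ENNReal.ofReal (L f) ∂μ

/-- The posterior law `p(f | data) = p(data | f) p(f) / p(data)`. -/
noncomputable def bayesPosterior (μ : Measure F) (L : F → ℝ) : Measure F :=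
  (evidence μ L)⁻¹ • μ.withDensity fun f => ENNReal.ofReal (L f)

end Bayes

/-! ### The affine probit likelihood and the updated parameters -/

section Affine

variable {E σ ν α : Type*} [Fintype σ] [DecidableEq σ] [Fintype ν] [DecidableEq ν]
  [Fintype α] [DecidableEq α]

/-- The affine probit likelihood `Φ_{m_a}(Z + W f(X); S)`. -/
noncomputable def affineProbit (X : ν → E) (W : Matrix α ν ℝ) (Z : α → ℝ) (S : Matrix α α ℝ)
    (f : E → ℝ) : ℝ :=
  gaussCDF S (Z + W *ᵥ fun j => f (X j))

/-- `Δ̃(x) = [Δ(x), D_{Ω(x,x)}⁻¹ Ω(x,X) Wᵀ]`. -/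
noncomputable def postSkew (K : E → E → ℝ) (Δ : E → σ → ℝ) (X : ν → E) (W : Matrix α ν ℝ)
    (x : E) : σ ⊕ α → ℝ :=
  Sum.elim (Δ x) fun k => (Real.sqrt (K x x))⁻¹ * ∑ j, K x (X j) * W k j

/-- `γ_p = [γ, Z + W ξ(X)]`. -/
noncomputable def postGamma (ξ : E → ℝ) (γ : σ → ℝ) (X : ν → E) (W : Matrix α ν ℝ)
    (Z : α → ℝ) : σ ⊕ α → ℝ :=
  Sum.elim γ (Z + W *ᵥ fun j => ξ (X j))

/-- `Γ_p = [Γ, Δ(X)ᵀ D_Ω Wᵀ; W D_Ω Δ(X), W Ω(X,X) Wᵀ + S]`. -/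
noncomputable def postCov (K : E → E → ℝ) (Δ : E → σ → ℝ) (Γ : Matrix σ σ ℝ) (X : ν → E)
    (W : Matrix α ν ℝ) (S : Matrix α α ℝ) : Matrix (σ ⊕ α) (σ ⊕ α) ℝ :=
  Matrix.fromBlocks Γ
    ((skewMatrix Δ X)ᵀ * stdDev (scaleMatrix K X) * Wᵀ)
    (W * stdDev (scaleMatrix K X) * skewMatrix Δ X)
    (W * scaleMatrix K X * Wᵀ + S)

end Affine

/-! ### Classification, preference and ordinal likelihoods -/

section Likelihoods

variable {E ν α : Type*} [Fintype ν] [DecidableEq ν] [Fintype α]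

/-- The standard normal distribution function, extended to `±∞`. -/
noncomputable def stdNormalCDF (t : EReal) : ℝ :=
  (gaussianReal 0 1).real {v : ℝ | (v : EReal) ≤ t}

/-- Probit classification with labels `y i ∈ {-1, 1}`: `∏ i, Φ(y_i f(x_i))`. -/
noncomputable def classLik (X : ν → E) (y : ν → ℝ) (f : E → ℝ) : ℝ :=
  ∏ i, stdNormalCDF ((y i * f (X i) : ℝ) : EReal)

/-- Preference learning: the `k`-th observation says that input `X (v k)` is preferred to input
`X (u k)`, with noise level `τ`: `∏ k, Φ((f(v_k) - f(u_k)) / (√2 τ))`. -/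
noncomputable def prefLik (X : ν → E) (v u : α → ν) (τ : ℝ) (f : E → ℝ) : ℝ :=
  ∏ k, stdNormalCDF (((f (X (v k)) - f (X (u k))) / (Real.sqrt 2 * τ) : ℝ) : EReal)

/-- The matrix `W` of the preference likelihood. -/
noncomputable def prefW (v u : α → ν) (τ : ℝ) : Matrix α ν ℝ :=
  Matrix.of fun k j =>
    ((if v k = j then 1 else 0) - (if u k = j then 1 else 0)) / (Real.sqrt 2 * τ)

variable {r : ℕ}

/-- Ordinal regression with categories `j : Fin r`, category `j` being the interval
`(b j, b (j + 1)]`, and noise level `τ`: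
`∏ i, (Φ((b_{y_i + 1} - f(x_i)) / τ) - Φ((b_{y_i} - f(x_i)) / τ))`. -/
noncomputable def ordLik (X : ν → E) (b : Fin (r + 1) → EReal) (y : ν → Fin r) (τ : ℝ)
    (f : E → ℝ) : ℝ :=
  ∏ i, (stdNormalCDF ((b (y i).succ - (f (X i) : EReal)) / (τ : EReal)) -
    stdNormalCDF ((b (y i).castSucc - (f (X i) : EReal)) / (τ : EReal)))

/-- The finite cut points that bound the observed categories: one (upper) coordinate for each
observation whose category is bounded above, one (lower) for each that is bounded below. -/
abbrev OrdIdx (b : Fin (r + 1) → EReal) (y : ν → Fin r) : Type _ :=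
  {i : ν // b (y i).succ ≠ ⊤} ⊕ {i : ν // b (y i).castSucc ≠ ⊥}

/-- The observation a coordinate belongs to. -/
def OrdIdx.obs {b : Fin (r + 1) → EReal} {y : ν → Fin r} : OrdIdx b y → ν :=
  Sum.elim Subtype.val Subtype.val

/-- `1` for an upper cut point, `-1` for a lower one. -/
def OrdIdx.sign {b : Fin (r + 1) → EReal} {y : ν → Fin r} : OrdIdx b y → ℝ :=
  Sum.elim (fun _ => 1) (fun _ => -1)

/-- The cut point itself. -/
noncomputable def OrdIdx.cut {b : Fin (r + 1) → EReal} {y : ν → Fin r} : OrdIdx b y → ℝ :=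
  Sum.elim (fun i => (b (y i).succ).toReal) (fun i => (b (y i).castSucc).toReal)

/-- The matrix `W` of the ordinal likelihood. -/
noncomputable def ordW (b : Fin (r + 1) → EReal) (y : ν → Fin r) (τ : ℝ) :
    Matrix (OrdIdx b y) ν ℝ :=
  Matrix.of fun p j => if p.obs = j then -(p.sign / τ) else 0

/-- The shift `Z` of the ordinal likelihood. -/
noncomputable def ordZ (b : Fin (r + 1) → EReal) (y : ν → Fin r) (τ : ℝ) : OrdIdx b y → ℝ :=
  fun p => p.sign * p.cut / τ

/-- The noise covariance of the ordinal likelihood: the two coordinates of one observation share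
their noise with opposite signs, so that the matrix is singular as soon as a category that is
bounded on both sides is observed. -/
def ordS (b : Fin (r + 1) → EReal) (y : ν → Fin r) : Matrix (OrdIdx b y) (OrdIdx b y) ℝ :=
  Matrix.of fun p q => if p.obs = q.obs then p.sign * q.sign else 0

end Likelihoods

end SkewGP

/-! A SUN law is a conditioned Gaussian. Take (T, V) centred Gaussian with covariance `latentCov`;
then SUN(ξ, Ω, Δ, γ, Γ) is the law of ξ + V given T ≤ γ (`sunMeasure_eq_conditioned`). This follows
from the regression of T on V: T = U - mV with U independent of V and with the Schur complement as
covariance, so that P(T ≤ γ | V = v) is the skewing factor of the density.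

An affine probit likelihood is also the probability of an orthant: Φ(Z + W f(X); S) = P(ε ≤ Z + W
f(X)) with ε ~ N(0, S) independent of the prior. For f = ξ + V this event reads ε - W V(X) ≤ Z + W
ξ(X). Multiplying by the likelihood therefore only adds the coordinates ε - W V(X) to T and the
bounds Z + W ξ(X) to γ (`map_withDensity_affineProbit`). The updated parameters are the covariance
of the enlarged vector, a linear image of (T, V, ε) (`updateMatrix_conj`). Definiteness survives
because that linear map has full row rank (`updateMatrix_vecMul_injective`).

Classification and preference likelihoods are affine probits with independent noise. In the ordinal
case the two cut points of a category share one noise variable with opposite signs, so S may be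
singular. Gaussian laws are thus treated through characteristic functions, with densities only where
the covariance is definite, and positivity of the likelihood is proved separately. -/

set_option linter.unusedSectionVars false

namespace SkewGP

/-! ### Centred Gaussian laws, possibly singular: linear images, products, densities -/

section GaussianLaw

variable {ι κ : Type*} [Fintype ι] [DecidableEq ι] [Fintype κ] [DecidableEq κ]

/-- The centred Gaussian law with covariance `M`, as a measure on `ι → ℝ`. -/
noncomputable def gaussLaw (M : Matrix ι ι ℝ) : Measure (ι → ℝ) :=
  (multivariateGaussian (0 : EuclideanSpace ℝ ι) M).map (WithLp.ofLp)

instance (M : Matrix ι ι ℝ) : IsProbabilityMeasure (gaussLaw M) :=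
  Measure.isProbabilityMeasure_map (by fun_prop)

lemma measurableSet_lower (a : ι → ℝ) : MeasurableSet {z : ι → ℝ | ∀ i, z i ≤ a i} := by
  have : {z : ι → ℝ | ∀ i, z i ≤ a i} = ⋂ i, {z | z i ≤ a i} := by ext; simp
  rw [this]
  exact MeasurableSet.iInter fun i => measurableSet_le (measurable_pi_apply i) measurable_const

lemma gaussCDF_eq (M : Matrix ι ι ℝ) (a : ι → ℝ) :
    gaussCDF M a = (gaussLaw M).real {z | ∀ i, z i ≤ a i} := by
  rw [gaussCDF, gaussLaw, measureReal_def, measureReal_def,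
    Measure.map_apply (by fun_prop) (measurableSet_lower a)]
  rfl

lemma ofReal_gaussCDF (M : Matrix ι ι ℝ) (a : ι → ℝ) :
    ENNReal.ofReal (gaussCDF M a) = gaussLaw M {z | ∀ i, z i ≤ a i} := by
  rw [gaussCDF_eq, ofReal_measureReal]

/-- The characteristic function of `μ` is that of the centred Gaussian with covariance `M`. -/
def HasGaussCharFun (μ : Measure (ι → ℝ)) (M : Matrix ι ι ℝ) : Prop :=
  ∀ t : ι → ℝ, ∫ z, Complex.exp (((t ⬝ᵥ z : ℝ) : ℂ) * Complex.I) ∂μ =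
    Complex.exp (((-(t ⬝ᵥ M *ᵥ t) / 2 : ℝ) : ℂ))

lemma charFun_map_toLp (μ : Measure (ι → ℝ)) (t : EuclideanSpace ℝ ι) :
    charFun (μ.map (WithLp.toLp 2)) t =
      ∫ z, Complex.exp (((t.ofLp ⬝ᵥ z : ℝ) : ℂ) * Complex.I) ∂μ := by
  rw [charFun_apply, integral_map (by fun_prop) (by fun_prop)]
  simp [PiLp.inner_apply, dotProduct]

/-- Characteristic functions determine finite measures on an inner product space, so both measures
are carried to `EuclideanSpace` and back. -/
lemma HasGaussCharFun.eq {μ ν : Measure (ι → ℝ)} [IsFiniteMeasure μ] [IsFiniteMeasure ν]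
    {M : Matrix ι ι ℝ} (hμ : HasGaussCharFun μ M) (hν : HasGaussCharFun ν M) : μ = ν := by
  have h : μ.map (WithLp.toLp 2) = ν.map (WithLp.toLp 2) := by
    apply Measure.ext_of_charFun (E := EuclideanSpace ℝ ι)
    ext t
    rw [charFun_map_toLp, charFun_map_toLp, hμ, hν]
  have h2 := congrArg (Measure.map (WithLp.ofLp (p := 2) (V := ι → ℝ))) h
  rwa [Measure.map_map (by fun_prop) (by fun_prop), Measure.map_map (by fun_prop) (by fun_prop),
    show (WithLp.ofLp ∘ WithLp.toLp 2 : (ι → ℝ) → ι → ℝ) = id from rfl,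
    Measure.map_id, Measure.map_id] at h2

lemma hasGaussCharFun_gaussLaw {M : Matrix ι ι ℝ} (hM : M.PosSemidef) :
    HasGaussCharFun (gaussLaw M) M := by
  intro t
  have h := charFun_multivariateGaussian (μ := 0) hM (WithLp.toLp 2 t)
  have e : (multivariateGaussian (0 : EuclideanSpace ℝ ι) M) =
      (gaussLaw M).map (WithLp.toLp 2) := by
    rw [gaussLaw, Measure.map_map (by fun_prop) (by fun_prop)]
    exact Measure.map_id.symm
  rw [e, charFun_map_toLp] at h
  rw [h]
  simp [neg_div]

lemma HasGaussCharFun.eq_gaussLaw {μ : Measure (ι → ℝ)} [IsFiniteMeasure μ]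
    {M : Matrix ι ι ℝ} (hμ : HasGaussCharFun μ M) (hM : M.PosSemidef) : μ = gaussLaw M :=
  hμ.eq (hasGaussCharFun_gaussLaw hM)

lemma measurable_mulVec (C : Matrix κ ι ℝ) : Measurable fun z : ι → ℝ => C *ᵥ z :=
  (Matrix.mulVecLin C).continuous_of_finiteDimensional.measurable

/-- The identity t ⬝ Cz = (Cᵀt) ⬝ z reduces the claim to the characteristic function of `μ` at Cᵀt.
-/
lemma HasGaussCharFun.map_mulVec {μ : Measure (ι → ℝ)} {M : Matrix ι ι ℝ}
    (hμ : HasGaussCharFun μ M) (C : Matrix κ ι ℝ) :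
    HasGaussCharFun (μ.map fun z => C *ᵥ z) (C * M * Cᵀ) := by
  intro t
  rw [integral_map (measurable_mulVec C).aemeasurable
    (Continuous.aestronglyMeasurable (by unfold dotProduct; fun_prop))]
  have := hμ (t ᵥ* C)
  simp only [← Matrix.dotProduct_mulVec] at this
  rw [this]
  congr 4
  rw [← Matrix.mulVec_mulVec, Matrix.mulVec_transpose, ← Matrix.mulVec_mulVec]

lemma posSemidef_conj {M : Matrix ι ι ℝ} (hM : M.PosSemidef) (C : Matrix κ ι ℝ) :
    (C * M * Cᵀ).PosSemidef := by
  simpa using hM.mul_mul_conjTranspose_same C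

lemma gaussLaw_map_mulVec {M : Matrix ι ι ℝ} (hM : M.PosSemidef) (C : Matrix κ ι ℝ) :
    (gaussLaw M).map (fun z => C *ᵥ z) = gaussLaw (C * M * Cᵀ) :=
  have := Measure.isProbabilityMeasure_map (μ := gaussLaw M) (measurable_mulVec C).aemeasurable
  ((hasGaussCharFun_gaussLaw hM).map_mulVec C).eq_gaussLaw (posSemidef_conj hM C)

lemma measurable_sumElim :
    Measurable fun p : (ι → ℝ) × (κ → ℝ) => Sum.elim p.1 p.2 := by
  refine measurable_pi_lambda _ fun i => ?_
  rcases i with i | i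
  · exact (measurable_pi_apply i).comp measurable_fst
  · exact (measurable_pi_apply i).comp measurable_snd

lemma posSemidef_fromBlocks_diag {A : Matrix ι ι ℝ} {B : Matrix κ κ ℝ} (hA : A.PosSemidef)
    (hB : B.PosSemidef) : (Matrix.fromBlocks A 0 0 B).PosSemidef := by
  refine .of_dotProduct_mulVec_nonneg ?_ fun x => ?_
  · exact hA.1.fromBlocks (by simp) hB.1
  · rw [Matrix.fromBlocks_mulVec, ← Sum.elim_comp_inl_inr (star x)]
    simp only [sumElim_dotProduct_sumElim, Matrix.zero_mulVec, add_zero, zero_add]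
    exact add_nonneg (hA.dotProduct_mulVec_nonneg _) (hB.dotProduct_mulVec_nonneg _)

/-- By independence the characteristic function factors, and the quadratic form of a block diagonal
matrix splits accordingly. -/
lemma gaussLaw_prod {A : Matrix ι ι ℝ} {B : Matrix κ κ ℝ} (hA : A.PosSemidef)
    (hB : B.PosSemidef) :
    ((gaussLaw A).prod (gaussLaw B)).map (fun p => Sum.elim p.1 p.2) =
      gaussLaw (Matrix.fromBlocks A 0 0 B) := by
  have := Measure.isProbabilityMeasure_map (μ := (gaussLaw A).prod (gaussLaw B))
    measurable_sumElim.aemeasurable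
  refine HasGaussCharFun.eq_gaussLaw (fun t => ?_) (posSemidef_fromBlocks_diag hA hB)
  rw [integral_map measurable_sumElim.aemeasurable
    (Continuous.aestronglyMeasurable (by unfold dotProduct; fun_prop))]
  have h1 := hasGaussCharFun_gaussLaw hA (t ∘ Sum.inl)
  have h2 := hasGaussCharFun_gaussLaw hB (t ∘ Sum.inr)
  rw [Matrix.fromBlocks_mulVec]
  nth_rw 2 [← Sum.elim_comp_inl_inr t]
  have e : ∀ p : (ι → ℝ) × (κ → ℝ), t ⬝ᵥ Sum.elim p.1 p.2 =
      (t ∘ Sum.inl) ⬝ᵥ p.1 + (t ∘ Sum.inr) ⬝ᵥ p.2 := fun p => by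
    conv_lhs => rw [← Sum.elim_comp_inl_inr t]
    rw [sumElim_dotProduct_sumElim]
  simp only [e, Complex.ofReal_add, add_mul, Complex.exp_add]
  rw [integral_prod_mul (μ := gaussLaw A) (ν := gaussLaw B)
    (fun x => Complex.exp (((t ∘ Sum.inl) ⬝ᵥ x : ℝ) * Complex.I))
    (fun x => Complex.exp (((t ∘ Sum.inr) ⬝ᵥ x : ℝ) * Complex.I)), h1, h2, ← Complex.exp_add]
  rw [sumElim_dotProduct_sumElim]
  simp only [Matrix.zero_mulVec, add_zero, zero_add]
  congr 1
  push_cast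
  ring

lemma gaussLaw_one : gaussLaw (1 : Matrix ι ι ℝ) = Measure.pi fun _ => gaussianReal 0 1 := by
  rw [gaussLaw, multivariateGaussian_zero_one, ← map_pi_eq_stdGaussian,
    Measure.map_map (by fun_prop) (by fun_prop)]
  exact Measure.map_id

lemma continuous_gaussPDF (Ω : Matrix ι ι ℝ) : Continuous (gaussPDF Ω) := by
  have : Continuous fun z : ι → ℝ => Ω⁻¹ *ᵥ z :=
    (Matrix.mulVecLin Ω⁻¹).continuous_of_finiteDimensional
  unfold gaussPDF dotProduct
  fun_prop

lemma gaussPDF_one (z : ι → ℝ) :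
    gaussPDF (1 : Matrix ι ι ℝ) z = ∏ i, gaussianPDFReal 0 1 (z i) := by
  simp only [gaussPDF, gaussianPDFReal, Finset.prod_mul_distrib, ← Real.exp_sum, Matrix.det_one,
    Finset.prod_const, Finset.card_univ, inv_one, Matrix.one_mulVec, dotProduct]
  congr 1
  · rw [inv_pow]
    simp only [NNReal.coe_one, mul_one]
    rw [Real.sqrt_eq_rpow, Real.sqrt_eq_rpow, ← Real.rpow_natCast, ← Real.rpow_natCast,
      ← Real.rpow_mul (by positivity), ← Real.rpow_mul (by positivity), mul_comm (1 / 2 : ℝ)]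
  · congr 1
    rw [← Finset.sum_div, Finset.sum_neg_distrib]
    simp [sq]

/-- Both sides are compared on boxes, where the integral of the product density factors by Fubini.
-/
lemma gaussLaw_one_eq_withDensity :
    gaussLaw (1 : Matrix ι ι ℝ) =
      volume.withDensity fun z => ENNReal.ofReal (gaussPDF 1 z) := by
  rw [gaussLaw_one]
  refine Measure.pi_eq fun s hs => ?_
  have hi : ∀ i, Integrable ((s i).indicator (gaussianPDFReal 0 1)) := fun i =>
    (integrable_gaussianPDFReal 0 1).indicator (hs i)
  rw [withDensity_apply _ (MeasurableSet.univ_pi hs),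
    ← lintegral_indicator (MeasurableSet.univ_pi hs)]
  have e : (fun z : ι → ℝ => (Set.univ.pi s).indicator
      (fun z => ENNReal.ofReal (gaussPDF 1 z)) z) =
      fun z => ENNReal.ofReal (∏ i, (s i).indicator (gaussianPDFReal 0 1) (z i)) := by
    ext z
    by_cases hz : z ∈ Set.univ.pi s
    · rw [Set.indicator_of_mem hz, gaussPDF_one]
      congr 1
      exact Finset.prod_congr rfl fun i _ => (Set.indicator_of_mem (hz i trivial) _).symm
    · rw [Set.indicator_of_notMem hz]
      obtain ⟨i, hi⟩ : ∃ i, z i ∉ s i := by simpa [Set.mem_pi] using hz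
      rw [Finset.prod_eq_zero (Finset.mem_univ i) (Set.indicator_of_notMem hi _)]
      simp
  have hint : Integrable fun z : ι → ℝ => ∏ i, (s i).indicator (gaussianPDFReal 0 1) (z i) :=
    Integrable.fintype_prod (f := fun i => (s i).indicator (gaussianPDFReal 0 1)) hi
  rw [e, ← ofReal_integral_eq_lintegral_ofReal hint
    (Filter.Eventually.of_forall fun z => Finset.prod_nonneg fun i _ =>
      Set.indicator_nonneg (fun x _ => gaussianPDFReal_nonneg 0 1 x) _),
    integral_fintype_prod_volume_eq_prod (f := fun i => (s i).indicator (gaussianPDFReal 0 1)),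
    ENNReal.ofReal_prod_of_nonneg fun i _ => integral_nonneg fun x =>
      Set.indicator_nonneg (fun x _ => gaussianPDFReal_nonneg 0 1 x) _]
  refine Finset.prod_congr rfl fun i _ => ?_
  rw [integral_indicator (hs i), gaussianReal_apply_eq_integral 0 one_ne_zero]

lemma exists_mul_transpose_eq {M : Matrix ι ι ℝ} (hM : M.PosSemidef) :
    ∃ R : Matrix ι ι ℝ, R * Rᵀ = M := by
  open scoped MatrixOrder in
  refine ⟨CFC.sqrt M, ?_⟩
  have h : (CFC.sqrt M)ᵀ = CFC.sqrt M := by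
    have := (CFC.sqrt_nonneg M).isSelfAdjoint
    rwa [IsSelfAdjoint, Matrix.star_eq_conjTranspose, Matrix.conjTranspose_eq_transpose_of_trivial]
      at this
  rw [h, CFC.sqrt_mul_sqrt_self _ hM.nonneg]

/-- Writing Ω = R Rᵀ makes the law the image of the standard Gaussian under R; the density then
comes from the linear change of variables, with Jacobian |det R|. -/
lemma gaussLaw_eq_withDensity {Ω : Matrix ι ι ℝ} (hΩ : Ω.PosDef) :
    gaussLaw Ω = volume.withDensity fun z => ENNReal.ofReal (gaussPDF Ω z) := by
  obtain ⟨R, hR⟩ := exists_mul_transpose_eq hΩ.posSemidef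
  have hdet : R.det * R.det = Ω.det := by rw [← hR, Matrix.det_mul, Matrix.det_transpose]
  have hd : R.det ≠ 0 := fun h => by
    have := hΩ.det_pos; rw [← hdet, h] at this; simp at this
  have hu : IsUnit R.det := hd.isUnit
  have h1 : gaussLaw Ω = (gaussLaw 1).map fun z => R *ᵥ z := by
    rw [gaussLaw_map_mulVec .one, Matrix.mul_one, hR]
  have hmul : ∀ z, R⁻¹ *ᵥ (R *ᵥ z) = z := fun z => by
    rw [Matrix.mulVec_mulVec, Matrix.nonsing_inv_mul _ hu, Matrix.one_mulVec]
  have hpdf : ∀ z, gaussPDF Ω (R *ᵥ z) = |R.det|⁻¹ * gaussPDF 1 z := fun z => by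
    unfold gaussPDF
    rw [← mul_assoc]
    congr 1
    · rw [Matrix.det_one, mul_one, ← hdet, Real.sqrt_mul (by positivity), Real.sqrt_mul_self_eq_abs,
        mul_inv, mul_comm]
    · congr 3
      rw [inv_one, Matrix.one_mulVec, ← hR, Matrix.mul_inv_rev, ← Matrix.mulVec_mulVec, hmul,
        dotProduct_comm, Matrix.dotProduct_mulVec, Matrix.vecMul_mulVec, ← Matrix.transpose_nonsing_inv,
        Matrix.transpose_transpose, Matrix.nonsing_inv_mul _ hu, Matrix.vecMul_one]
  rw [h1, gaussLaw_one_eq_withDensity]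
  ext A hA
  rw [Measure.map_apply (measurable_mulVec R) hA,
    withDensity_apply _ (measurable_mulVec R hA), withDensity_apply _ hA]
  have hvol := Real.map_matrix_volume_pi_eq_smul_volume_pi hd
  -- Lebesgue measure is written as a multiple of its own image under R, so that the right-hand
  -- integral pulls back along R.
  have hvol2 : (volume : Measure (ι → ℝ)) =
      ENNReal.ofReal |R.det| • Measure.map (fun z => R *ᵥ z) volume := by
    have : Measure.map (fun z => R *ᵥ z) volume = ENNReal.ofReal |(R.det)⁻¹| • volume := hvol
    rw [this, smul_smul, ← ENNReal.ofReal_mul (abs_nonneg _), ← abs_mul, mul_inv_cancel₀ hd]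
    simp
  conv_rhs => rw [hvol2]
  rw [Measure.restrict_smul, lintegral_smul_measure,
    setLIntegral_map hA (by have := continuous_gaussPDF Ω; fun_prop) (measurable_mulVec R),
    smul_eq_mul, ← lintegral_const_mul _ (by
      have := (continuous_gaussPDF Ω).measurable.comp (measurable_mulVec R)
      exact this.ennreal_ofReal)]
  refine lintegral_congr fun z => ?_
  rw [hpdf, ← ENNReal.ofReal_mul (abs_nonneg _), mul_inv_cancel_left₀ (abs_ne_zero.2 hd)]

lemma gaussPDF_pos {Ω : Matrix ι ι ℝ} (hΩ : Ω.PosDef) (z : ι → ℝ) : 0 < gaussPDF Ω z := by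
  have := hΩ.det_pos
  unfold gaussPDF
  positivity

/-- The density is positive everywhere and the orthant contains an open unit cube. Definiteness
matters: a singular Gaussian may give an orthant measure zero. -/
lemma gaussCDF_pos {M : Matrix ι ι ℝ} (hM : M.PosDef) (a : ι → ℝ) : 0 < gaussCDF M a := by
  rw [← ENNReal.ofReal_pos, ofReal_gaussCDF, gaussLaw_eq_withDensity hM,
    withDensity_apply _ (measurableSet_lower a), setLIntegral_pos_iff
      (continuous_gaussPDF M).measurable.ennreal_ofReal]
  have hsup : (Function.support fun z => ENNReal.ofReal (gaussPDF M z)) = Set.univ := by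
    ext z; simpa using gaussPDF_pos hM z
  rw [hsup, Set.univ_inter]
  refine lt_of_lt_of_le ?_ (measure_mono (s := Set.univ.pi fun i => Set.Ioo (a i - 1) (a i)) ?_)
  · rw [volume_pi_pi]
    simp
  · exact fun z hz i => (hz i trivial).2.le

end GaussianLaw

/-! ### The SUN law as a conditioned Gaussian -/

section Representation

variable {ι σ : Type*} [Fintype ι] [DecidableEq ι] [Fintype σ] [DecidableEq σ]

lemma isUnit_stdDev {Ω : Matrix ι ι ℝ} (h : ∀ i, 0 < Ω i i) : IsUnit (stdDev Ω).det := by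
  rw [stdDev, Matrix.det_diagonal]
  exact (Finset.prod_ne_zero_iff.2 fun i _ => (Real.sqrt_pos.2 (h i)).ne').isUnit

lemma stdDev_transpose (Ω : Matrix ι ι ℝ) : (stdDev Ω)ᵀ = stdDev Ω := Matrix.diagonal_transpose _

lemma stdDev_inv_transpose (Ω : Matrix ι ι ℝ) : ((stdDev Ω)⁻¹)ᵀ = (stdDev Ω)⁻¹ := by
  rw [Matrix.transpose_nonsing_inv, stdDev_transpose]

lemma stdDev_mul_corr_mul {Ω : Matrix ι ι ℝ} (h : ∀ i, 0 < Ω i i) :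
    stdDev Ω * corr Ω * stdDev Ω = Ω := by
  have hu := isUnit_stdDev h
  rw [corr, Matrix.mul_assoc (stdDev Ω)⁻¹, Matrix.mul_nonsing_inv_cancel_left _ _ hu,
    Matrix.nonsing_inv_mul_cancel_right _ _ hu]

/-- Were a diagonal entry nonpositive, its square root would be 0 and D singular. The inverse of a
singular matrix is 0 by convention, so the correlation matrix would vanish. -/
lemma diag_pos_of_corr_posDef {Ω : Matrix ι ι ℝ} (h : (corr Ω).PosDef) (i : ι) : 0 < Ω i i := by
  by_contra hi
  have hdet : (stdDev Ω).det = 0 := by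
    rw [stdDev, Matrix.det_diagonal]
    exact Finset.prod_eq_zero (Finset.mem_univ i) (Real.sqrt_eq_zero_of_nonpos (not_lt.1 hi))
  have h0 : corr Ω = 0 := by
    rw [corr, Matrix.nonsing_inv_apply_not_isUnit _ (by simp [hdet])]
    simp
  have := h.diag_pos (i := i)
  simp [h0] at this

lemma vecMul_injective_of_isUnit {A : Matrix ι ι ℝ} (h : IsUnit A.det) :
    Function.Injective A.vecMul := by
  intro x y hxy
  have := congrArg (fun v => v ᵥ* A⁻¹) hxy
  simpa [Matrix.vecMul_vecMul, Matrix.mul_nonsing_inv _ h] using this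

lemma posDef_of_corr_posDef {Ω : Matrix ι ι ℝ} (h : (corr Ω).PosDef) : Ω.PosDef := by
  have hd := diag_pos_of_corr_posDef h
  have := h.mul_mul_conjTranspose_same (vecMul_injective_of_isUnit (isUnit_stdDev hd))
  rwa [Matrix.conjTranspose_eq_transpose_of_trivial, stdDev_transpose, stdDev_mul_corr_mul hd]
    at this

lemma corr_posDef {Ω : Matrix ι ι ℝ} (h : Ω.PosDef) : (corr Ω).PosDef := by
  have hu := isUnit_stdDev fun i => h.diag_pos (i := i)
  have := h.mul_mul_conjTranspose_same (B := (stdDev Ω)⁻¹)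
    (vecMul_injective_of_isUnit (by rw [Matrix.det_nonsing_inv]; exact hu.ringInverse))
  rwa [Matrix.conjTranspose_eq_transpose_of_trivial, stdDev_inv_transpose] at this

/-- The covariance matrix `[Γ, -ΔᵀD; -DΔ, Ω]` of the pair `(T, V)` for which
`SUN(ξ, Ω, Δ, γ, Γ)` is the law of `ξ + V` given `T ≤ γ`. -/
noncomputable def latentCov (Ω : Matrix ι ι ℝ) (Δ : Matrix ι σ ℝ) (Γ : Matrix σ σ ℝ) :
    Matrix (σ ⊕ ι) (σ ⊕ ι) ℝ :=
  Matrix.fromBlocks Γ (-(Δᵀ * stdDev Ω)) (-(stdDev Ω * Δ)) Ω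

/-- Undoing the standardisation and reversing the sign of V turns `jointMatrix` into `latentCov`.
The sign is what makes the conditioning event T ≤ γ rather than T ≥ -γ. -/
lemma latentCov_eq_conj {Ω : Matrix ι ι ℝ} (h : ∀ i, 0 < Ω i i) (Δ : Matrix ι σ ℝ)
    (Γ : Matrix σ σ ℝ) :
    latentCov Ω Δ Γ = Matrix.fromBlocks 1 0 0 (-stdDev Ω) * jointMatrix Ω Δ Γ *
      (Matrix.fromBlocks 1 0 0 (-stdDev Ω))ᵀ := by
  simp [latentCov, jointMatrix, Matrix.fromBlocks_transpose, Matrix.fromBlocks_multiply,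
    stdDev_transpose, stdDev_mul_corr_mul h]

lemma jointMatrix_eq_conj {Ω : Matrix ι ι ℝ} (h : ∀ i, 0 < Ω i i) (Δ : Matrix ι σ ℝ)
    (Γ : Matrix σ σ ℝ) :
    jointMatrix Ω Δ Γ = Matrix.fromBlocks 1 0 0 (-(stdDev Ω)⁻¹) * latentCov Ω Δ Γ *
      (Matrix.fromBlocks 1 0 0 (-(stdDev Ω)⁻¹))ᵀ := by
  have hu := isUnit_stdDev h
  simp [latentCov, jointMatrix, Matrix.fromBlocks_transpose, Matrix.fromBlocks_multiply,
    stdDev_inv_transpose, Matrix.mul_assoc, Matrix.mul_nonsing_inv _ hu,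
    Matrix.nonsing_inv_mul_cancel_left _ _ hu, corr]

lemma isUnit_fromBlocks_one {A : Matrix ι ι ℝ} (h : IsUnit A.det) :
    IsUnit (Matrix.fromBlocks (1 : Matrix σ σ ℝ) 0 0 (-A)).det := by
  rw [Matrix.det_fromBlocks_zero₂₁, Matrix.det_one, one_mul, Matrix.det_neg]
  exact (IsUnit.pow _ isUnit_one.neg).mul h

lemma latentCov_posDef {Ω : Matrix ι ι ℝ} (h : ∀ i, 0 < Ω i i) {Δ : Matrix ι σ ℝ}
    {Γ : Matrix σ σ ℝ} (hM : (jointMatrix Ω Δ Γ).PosDef) : (latentCov Ω Δ Γ).PosDef := by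
  rw [latentCov_eq_conj h, ← Matrix.conjTranspose_eq_transpose_of_trivial]
  exact hM.mul_mul_conjTranspose_same
    (vecMul_injective_of_isUnit (isUnit_fromBlocks_one (isUnit_stdDev h)))

lemma jointMatrix_posSemidef {Ω : Matrix ι ι ℝ} (h : ∀ i, 0 < Ω i i) {Δ : Matrix ι σ ℝ}
    {Γ : Matrix σ σ ℝ} (hM : (latentCov Ω Δ Γ).PosSemidef) : (jointMatrix Ω Δ Γ).PosSemidef := by
  rw [jointMatrix_eq_conj h]
  exact posSemidef_conj hM _

lemma jointMatrix_posDef {Ω : Matrix ι ι ℝ} (h : ∀ i, 0 < Ω i i) {Δ : Matrix ι σ ℝ}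
    {Γ : Matrix σ σ ℝ} (hM : (latentCov Ω Δ Γ).PosDef) : (jointMatrix Ω Δ Γ).PosDef := by
  rw [jointMatrix_eq_conj h, ← Matrix.conjTranspose_eq_transpose_of_trivial]
  exact hM.mul_mul_conjTranspose_same (vecMul_injective_of_isUnit (isUnit_fromBlocks_one
    (by rw [Matrix.det_nonsing_inv]; exact (isUnit_stdDev h).ringInverse)))

lemma schur_posSemidef {Ω : Matrix ι ι ℝ} (hΩ : Ω.PosDef) {Δ : Matrix ι σ ℝ}
    {Γ : Matrix σ σ ℝ} (hM : (jointMatrix Ω Δ Γ).PosSemidef) :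
    (Γ - Δᵀ * (corr Ω)⁻¹ * Δ).PosSemidef := by
  have hc := corr_posDef hΩ
  have := hc.isUnit.invertible
  simpa using (Matrix.PosDef.fromBlocks₂₂ Γ Δᵀ hc).1 (by simpa [jointMatrix] using hM)

/-- The matrix form of T = U - mV with U and V independent. Only Ω has to be invertible, so the
identity also serves the boundary case. -/
lemma latentCov_eq_regression {Ω : Matrix ι ι ℝ} (hΩ : Ω.PosDef) (Δ : Matrix ι σ ℝ)
    (Γ : Matrix σ σ ℝ) :
    Matrix.fromBlocks 1 (-(Δᵀ * (corr Ω)⁻¹ * (stdDev Ω)⁻¹)) 0 1 *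
      Matrix.fromBlocks (Γ - Δᵀ * (corr Ω)⁻¹ * Δ) 0 0 Ω *
      (Matrix.fromBlocks 1 (-(Δᵀ * (corr Ω)⁻¹ * (stdDev Ω)⁻¹)) 0 1)ᵀ = latentCov Ω Δ Γ := by
  have hd : ∀ i, 0 < Ω i i := fun i => hΩ.diag_pos
  have hu := isUnit_stdDev hd
  have hc := corr_posDef hΩ
  have hcu : IsUnit (corr Ω).det := (Matrix.isUnit_iff_isUnit_det _).1 hc.isUnit
  have hct : ((corr Ω)⁻¹)ᵀ = (corr Ω)⁻¹ := by
    rw [Matrix.transpose_nonsing_inv]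
    exact congrArg _ (by simpa using hc.1 : (corr Ω).IsSymm)
  have h1 : Δᵀ * (corr Ω)⁻¹ * (stdDev Ω)⁻¹ * Ω = Δᵀ * stdDev Ω := by
    refine (congrArg (Δᵀ * (corr Ω)⁻¹ * (stdDev Ω)⁻¹ * ·) (stdDev_mul_corr_mul hd).symm).trans ?_
    simp only [Matrix.mul_assoc]
    rw [Matrix.nonsing_inv_mul_cancel_left _ _ hu, Matrix.nonsing_inv_mul_cancel_left _ _ hcu]
  have h2 : Ω * ((stdDev Ω)⁻¹ * ((corr Ω)⁻¹ * Δ)) = stdDev Ω * Δ := by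
    have := congrArg Matrix.transpose h1
    have hΩt : Ωᵀ = Ω := (by simpa using hΩ.1 : Ω.IsSymm)
    simpa [Matrix.transpose_mul, hct, stdDev_inv_transpose, stdDev_transpose, hΩt] using this
  have h3 : Δᵀ * stdDev Ω * ((stdDev Ω)⁻¹ * ((corr Ω)⁻¹ * Δ)) = Δᵀ * (corr Ω)⁻¹ * Δ := by
    simp only [Matrix.mul_assoc]
    rw [Matrix.mul_nonsing_inv_cancel_left _ _ hu]
  simp only [Matrix.fromBlocks_transpose, Matrix.fromBlocks_multiply, Matrix.transpose_neg,
    Matrix.transpose_mul, hct, stdDev_inv_transpose, Matrix.transpose_transpose, latentCov,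
    Matrix.one_mul, Matrix.mul_one, Matrix.zero_mul, Matrix.mul_zero, add_zero, zero_add,
    Matrix.neg_mul, Matrix.mul_neg, neg_neg, Matrix.transpose_one, Matrix.transpose_zero, h1, h2, h3,
    sub_add_cancel]

lemma measurableSet_latent (γ : σ → ℝ) :
    MeasurableSet {w : σ ⊕ ι → ℝ | ∀ k, w (.inl k) ≤ γ k} := by
  have : Measurable fun w : σ ⊕ ι → ℝ => fun k => w (.inl k) := by fun_prop
  exact this (measurableSet_lower γ)

/-- The SUN law is the law of `ξ + V` given `T ≤ γ`. -/
theorem sunMeasure_eq_conditioned {Ω : Matrix ι ι ℝ} (hΩ : Ω.PosDef) {Δ : Matrix ι σ ℝ}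
    {Γ : Matrix σ σ ℝ} (hM : (jointMatrix Ω Δ Γ).PosSemidef) (ξ : ι → ℝ) {γ : σ → ℝ}
    (hγ : 0 < gaussCDF Γ γ) :
    sunMeasure ξ Ω Δ γ Γ = (ENNReal.ofReal (gaussCDF Γ γ))⁻¹ •
      ((gaussLaw (latentCov Ω Δ Γ)).restrict {w | ∀ k, w (.inl k) ≤ γ k}).map
        fun w i => ξ i + w (.inr i) := by
  set S := Γ - Δᵀ * (corr Ω)⁻¹ * Δ with hS
  set m := Δᵀ * (corr Ω)⁻¹ * (stdDev Ω)⁻¹ with hm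
  have hSp : S.PosSemidef := schur_posSemidef hΩ hM
  have hmeas : Measurable fun w : σ ⊕ ι → ℝ => fun i => ξ i + w (.inr i) := by fun_prop
  have hC := measurable_mulVec (Matrix.fromBlocks (1 : Matrix σ σ ℝ) (-m) 0 (1 : Matrix ι ι ℝ))
  ext A hA
  have hE : MeasurableSet ((fun (w : σ ⊕ ι → ℝ) i => ξ i + w (.inr i)) ⁻¹' A ∩
      {w | ∀ k, w (.inl k) ≤ γ k}) := (hmeas hA).inter (measurableSet_latent γ)
  rw [Measure.smul_apply, smul_eq_mul, Measure.map_apply hmeas hA,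
    Measure.restrict_apply (hmeas hA), ← latentCov_eq_regression hΩ,
    ← gaussLaw_map_mulVec (posSemidef_fromBlocks_diag hSp hΩ.posSemidef),
    ← gaussLaw_prod hSp hΩ.posSemidef, Measure.map_apply hC hE,
    Measure.map_apply measurable_sumElim (hC hE)]
  set Q : Set ((σ → ℝ) × (ι → ℝ)) := _ ⁻¹' (_ ⁻¹' (_ ∩ _)) with hQ
  have hQm : MeasurableSet Q := measurable_sumElim (hC hE)
  -- For fixed V = v, the condition T = U - mv ≤ γ is U ≤ γ + mv, an orthant whose measure is the
  -- numerator of the skewing factor.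
  have hsec : ∀ v : ι → ℝ, gaussLaw S ((fun u => (u, v)) ⁻¹' Q) =
      A.indicator (fun z => ENNReal.ofReal (gaussCDF S (γ + m *ᵥ (z - ξ)))) (v + ξ) := by
    intro v
    have hmem : ∀ u, (u, v) ∈ Q ↔ v + ξ ∈ A ∧ ∀ k, u k ≤ (γ + m *ᵥ v) k := by
      intro u
      simp only [hQ, Set.mem_preimage, Set.mem_inter_iff, Set.mem_ofPred_eq,
        Matrix.fromBlocks_mulVec, Sum.elim_inl, Sum.elim_inr, Sum.elim_comp_inl,
        Sum.elim_comp_inr, Matrix.one_mulVec, Matrix.zero_mulVec, zero_add, Matrix.neg_mulVec,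
        Pi.add_apply, Pi.neg_apply]
      refine and_congr ?_ (forall_congr' fun k => ?_)
      · rw [show (fun i => ξ i + v i) = v + ξ from funext fun i => add_comm _ _]
      · constructor <;> intro h <;> linarith
    by_cases hv : v + ξ ∈ A
    · rw [Set.indicator_of_mem hv, add_sub_cancel_right, ofReal_gaussCDF]
      congr 1
      ext u
      simpa [hv] using hmem u
    · rw [Set.indicator_of_notMem hv]
      convert measure_empty (μ := gaussLaw S)
      ext u
      simpa [hv] using hmem u
  have hsm : Measurable fun v => gaussLaw S ((fun u => (u, v)) ⁻¹' Q) :=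
    measurable_measure_prodMk_right hQm
  -- Integrate over V last, with its density, then substitute z = v + ξ in the SUN integral.
  rw [Measure.prod_apply_symm hQm, gaussLaw_eq_withDensity hΩ,
    lintegral_withDensity_eq_lintegral_mul _ (continuous_gaussPDF Ω).measurable.ennreal_ofReal hsm,
    sunMeasure, withDensity_apply _ hA, ← lintegral_indicator hA,
    ← lintegral_const_mul _ ((continuous_gaussPDF Ω).measurable.ennreal_ofReal.mul hsm),
    ← lintegral_add_right_eq_self _ ξ]
  refine lintegral_congr fun v => ?_
  rw [Pi.mul_apply, hsec]
  by_cases hv : v + ξ ∈ A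
  · rw [Set.indicator_of_mem hv, Set.indicator_of_mem hv, sunPDF, ← hS, ← hm,
      ENNReal.ofReal_mul (gaussPDF_pos hΩ _).le, ENNReal.ofReal_div_of_pos hγ, add_sub_cancel_right,
      ENNReal.div_eq_inv_mul]
    ring
  · rw [Set.indicator_of_notMem hv, Set.indicator_of_notMem hv, mul_zero, mul_zero]

end Representation

/-! ### The linear update of the latent Gaussian vector -/

section Posterior

variable {E σ ν α : Type*} [Fintype σ] [DecidableEq σ] [Fintype ν] [DecidableEq ν]
  [Fintype α] [DecidableEq α]
  {ι κ : Type*} [Fintype ι] [DecidableEq ι] [Fintype κ] [DecidableEq κ]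

lemma selection_mul {τ : Type*} (b : ν → κ) (M : Matrix κ τ ℝ) :
    (1 : Matrix κ κ ℝ).submatrix b id * M = M.submatrix b id := by
  ext i j
  simp [Matrix.mul_apply, Matrix.one_apply]

lemma mul_selection {τ : Type*} (b : ν → κ) (M : Matrix τ κ ℝ) :
    M * ((1 : Matrix κ κ ℝ).submatrix b id)ᵀ = M.submatrix id b := by
  rw [← Matrix.transpose_inj, Matrix.transpose_mul, Matrix.transpose_transpose, selection_mul]
  rfl

lemma selection_mulVec (b : ν → κ) (v : κ → ℝ) :
    (1 : Matrix κ κ ℝ).submatrix b id *ᵥ v = v ∘ b := by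
  ext j
  simp [Matrix.mulVec, dotProduct, Matrix.one_apply]

/-- The linear map sending the latent pair `(T, V)` at the points `u` and the noise `ε` to the
latent pair `((T, ε - W V(X)), V(x))` at the points `x = u ∘ a`, where `X = u ∘ b`. -/
noncomputable def updateMatrix (σ : Type*) [DecidableEq σ] (W : Matrix α ν ℝ) (a : ι → κ)
    (b : ν → κ) : Matrix ((σ ⊕ α) ⊕ ι) ((σ ⊕ κ) ⊕ α) ℝ :=
  Matrix.fromBlocks
    (Matrix.fromBlocks 1 0 0 (-(W * (1 : Matrix κ κ ℝ).submatrix b id)))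
    (Matrix.fromRows 0 1)
    (Matrix.fromCols 0 ((1 : Matrix κ κ ℝ).submatrix a id))
    0

lemma stdDev_scaleMatrix_comp (K : E → E → ℝ) (u : κ → E) (a : ι → κ) (Δ : E → σ → ℝ) :
    (stdDev (scaleMatrix K u) * skewMatrix Δ u).submatrix a id =
      stdDev (scaleMatrix K (u ∘ a)) * skewMatrix Δ (u ∘ a) := by
  ext i k
  simp [stdDev, Matrix.diagonal_mul, scaleMatrix, skewMatrix]

/-- The updated parameters are exactly the covariances of the new latent vector: Cov(ε - W V(X),
V(x)) = -W Ω(X, x), Cov(T, ε - W V(X)) = Δ(X)ᵀ D Wᵀ, and the noise adds S to W Ω(X, X) Wᵀ. -/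
lemma updateMatrix_conj (K : E → E → ℝ) (Δ : E → σ → ℝ) (Γ : Matrix σ σ ℝ) (u : κ → E)
    (W : Matrix α ν ℝ) (S : Matrix α α ℝ) (a : ι → κ) (b : ν → κ)
    (hpos : ∀ i, 0 < K (u i) (u i)) (hsymm : ∀ i j, K (u i) (u j) = K (u j) (u i)) :
    updateMatrix σ W a b *
      Matrix.fromBlocks (latentCov (scaleMatrix K u) (skewMatrix Δ u) Γ) 0 0 S *
      (updateMatrix σ W a b)ᵀ =
    latentCov (scaleMatrix K (u ∘ a)) (skewMatrix (postSkew K Δ (u ∘ b) W) (u ∘ a))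
      (postCov K Δ Γ (u ∘ b) W S) := by
  have hΩt : (scaleMatrix K u)ᵀ = scaleMatrix K u := by
    ext i j
    exact hsymm j i
  have h22 : (1 : Matrix κ κ ℝ).submatrix a id * scaleMatrix K u *
      ((1 : Matrix κ κ ℝ).submatrix a id)ᵀ = scaleMatrix K (u ∘ a) := by
    rw [selection_mul, mul_selection]
    rfl
  have hDΔ : (1 : Matrix κ κ ℝ).submatrix b id * (stdDev (scaleMatrix K u) * skewMatrix Δ u) =
      stdDev (scaleMatrix K (u ∘ b)) * skewMatrix Δ (u ∘ b) := by
    rw [selection_mul, stdDev_scaleMatrix_comp]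
  have h11 : Matrix.fromBlocks Γ
        ((skewMatrix Δ u)ᵀ * stdDev (scaleMatrix K u) *
          (((1 : Matrix κ κ ℝ).submatrix b id)ᵀ * Wᵀ))
        (W * (1 : Matrix κ κ ℝ).submatrix b id * (stdDev (scaleMatrix K u) * skewMatrix Δ u))
        (W * (1 : Matrix κ κ ℝ).submatrix b id * scaleMatrix K u *
          (((1 : Matrix κ κ ℝ).submatrix b id)ᵀ * Wᵀ)) +
      Matrix.fromRows 0 (S * Matrix.fromCols (0 : Matrix α σ ℝ) (1 : Matrix α α ℝ)) =
        postCov K Δ Γ (u ∘ b) W S := by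
    have hS : Matrix.fromRows (0 : Matrix σ (σ ⊕ α) ℝ)
        (S * Matrix.fromCols (0 : Matrix α σ ℝ) (1 : Matrix α α ℝ)) = Matrix.fromBlocks 0 0 0 S := by
      rw [Matrix.mul_fromCols, Matrix.mul_zero, Matrix.mul_one, ← Matrix.fromCols_zero,
        Matrix.fromRows_fromCols_eq_fromBlocks]
    have hΔD := congrArg Matrix.transpose hDΔ
    simp only [Matrix.transpose_mul, stdDev_transpose] at hΔD
    rw [hS, Matrix.fromBlocks_add, add_zero, add_zero, add_zero, postCov, Matrix.mul_assoc W, hDΔ,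
      ← Matrix.mul_assoc _ _ Wᵀ, hΔD, ← Matrix.mul_assoc W, ← Matrix.mul_assoc _ _ Wᵀ,
      Matrix.mul_assoc W, Matrix.mul_assoc W, selection_mul, mul_selection]
    rfl
  have h21 : (-((1 : Matrix κ κ ℝ).submatrix a id *
        (stdDev (scaleMatrix K u) * skewMatrix Δ u))).fromCols
      (-((1 : Matrix κ κ ℝ).submatrix a id * scaleMatrix K u *
        (((1 : Matrix κ κ ℝ).submatrix b id)ᵀ * Wᵀ))) =
      -(stdDev (scaleMatrix K (u ∘ a)) * skewMatrix (postSkew K Δ (u ∘ b) W) (u ∘ a)) := by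
    rw [selection_mul, stdDev_scaleMatrix_comp, ← Matrix.mul_assoc _ _ Wᵀ, selection_mul,
      mul_selection]
    ext i (k | k)
    · simp [stdDev, Matrix.diagonal_mul, skewMatrix, postSkew]
    -- The factor D⁻¹ in the new skewness columns cancels against the D in `latentCov`, which needs
    -- positive variances.
    · have : √(K (u (a i)) (u (a i))) ≠ 0 := (Real.sqrt_pos.2 (hpos _)).ne'
      rw [stdDev, Matrix.neg_apply, Matrix.diagonal_mul]
      simp [skewMatrix, postSkew, scaleMatrix, Matrix.mul_apply, mul_inv_cancel_left₀ this]
  -- Symmetry of Ω makes the upper right block the transpose of the lower left one.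
  have h12 := congrArg Matrix.transpose h21
  simp only [Matrix.transpose_fromCols, Matrix.transpose_mul, Matrix.transpose_neg, hΩt,
    stdDev_transpose, Matrix.transpose_transpose, ← Matrix.mul_assoc] at h12
  simp only [updateMatrix, latentCov, Matrix.fromBlocks_transpose, Matrix.transpose_fromRows,
    Matrix.transpose_fromCols, Matrix.fromBlocks_multiply, Matrix.fromCols_mul_fromBlocks,
    Matrix.fromRows_mul, Matrix.fromBlocks_mul_fromRows, Matrix.fromCols_mul_fromRows,
    Matrix.zero_mul, Matrix.mul_zero, Matrix.one_mul, Matrix.mul_one,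
    add_zero, zero_add, Matrix.transpose_zero, Matrix.transpose_one,
    Matrix.neg_mul, Matrix.mul_neg, neg_neg, neg_zero,
    Matrix.transpose_neg, Matrix.transpose_mul, h22]
  rw [h11, h21]
  simp only [h12]

lemma updateMatrix_mulVec (W : Matrix α ν ℝ) (a : ι → κ) (b : ν → κ) (w : σ ⊕ κ → ℝ)
    (e : α → ℝ) :
    updateMatrix σ W a b *ᵥ Sum.elim w e =
      Sum.elim (Sum.elim (fun k => w (.inl k)) (e - W *ᵥ fun j => w (.inr (b j))))
        (fun i => w (.inr (a i))) := by
  ext i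
  rcases i with (i | i) | i <;>
  simp [updateMatrix, Matrix.fromBlocks_mulVec, Matrix.fromRows_mulVec, Matrix.fromCols_mulVec,
    Matrix.neg_mulVec, ← Matrix.mulVec_mulVec, selection_mulVec, neg_add_eq_sub, Function.comp_def]

/-- T, ε and the values of V at distinct points can be prescribed freely. A row vector x killed by
the matrix is tested against vectors chosen so that the pairing becomes the squared norm of one
block of x. -/
lemma updateMatrix_vecMul_injective (W : Matrix α ν ℝ) {a : ι → κ} (ha : Function.Injective a)
    (b : ν → κ) : Function.Injective (updateMatrix σ W a b).vecMul := by
  refine (injective_iff_map_eq_zero (Matrix.vecMulLinear (updateMatrix σ W a b))).2 fun x hx => ?_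
  have hx : x ᵥ* updateMatrix σ W a b = 0 := hx
  have key : ∀ (w : σ ⊕ κ → ℝ) (e : α → ℝ), x ⬝ᵥ updateMatrix σ W a b *ᵥ Sum.elim w e = 0 :=
    fun w e => by rw [Matrix.dotProduct_mulVec, hx, zero_dotProduct]
  have hs : (fun k => x (.inl (.inl k))) = 0 := by
    have := key (Sum.elim (fun k => x (.inl (.inl k))) 0) 0
    rw [updateMatrix_mulVec] at this
    rw [← dotProduct_self_eq_zero]
    simpa [dotProduct, Matrix.mulVec] using this
  have he : (fun k => x (.inl (.inr k))) = 0 := by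
    have := key 0 (fun k => x (.inl (.inr k)))
    rw [updateMatrix_mulVec] at this
    rw [← dotProduct_self_eq_zero]
    simpa [dotProduct, Matrix.mulVec] using this
  have hv : (fun i => x (.inr i)) = 0 := by
    -- Injectivity of `a` lets the last block of x be prescribed at the points u, with 0 elsewhere.
    -- These values also enter through W V(X), but that block of x is already known to vanish.
    have := key (Sum.elim 0 (Function.extend a (fun i => x (.inr i)) 0)) 0
    rw [updateMatrix_mulVec] at this
    rw [← dotProduct_self_eq_zero]
    have he' : ∀ k, x (.inl (.inr k)) = 0 := fun k => congrFun he k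
    simpa [dotProduct, ha.extend_apply, he'] using this
  ext i
  rcases i with (i | i) | i
  exacts [congrFun hs i, congrFun he i, congrFun hv i]

lemma posDef_fromBlocks_diag {A : Matrix ι ι ℝ} {B : Matrix κ κ ℝ} (hA : A.PosDef)
    (hB : B.PosDef) : (Matrix.fromBlocks A 0 0 B).PosDef := by
  rw [(posSemidef_fromBlocks_diag hA.posSemidef hB.posSemidef).posDef_iff_isUnit,
    Matrix.isUnit_iff_isUnit_det, Matrix.det_fromBlocks_zero₂₁]
  exact hA.det_pos.ne'.isUnit.mul hB.det_pos.ne'.isUnit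

end Posterior

/-! ### Bayes' rule as further conditioning -/

section PosteriorLaw

variable {E σ ν α : Type*} [Fintype σ] [DecidableEq σ] [Fintype ν] [DecidableEq ν]
  [Fintype α] [DecidableEq α]
  {ι κ : Type*} [Fintype ι] [DecidableEq ι] [Fintype κ] [DecidableEq κ]

/-- The marginal of T is the centred Gaussian with covariance Γ. -/
lemma gaussLaw_latentCov_lower {Ω : Matrix ι ι ℝ} {Δ : Matrix ι σ ℝ} {Γ : Matrix σ σ ℝ}
    (h : (latentCov Ω Δ Γ).PosSemidef) (γ : σ → ℝ) :
    gaussLaw (latentCov Ω Δ Γ) {w | ∀ k, w (.inl k) ≤ γ k} = ENNReal.ofReal (gaussCDF Γ γ) := by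
  have e : Matrix.fromCols (1 : Matrix σ σ ℝ) (0 : Matrix σ ι ℝ) * latentCov Ω Δ Γ *
      (Matrix.fromCols (1 : Matrix σ σ ℝ) (0 : Matrix σ ι ℝ))ᵀ = Γ := by
    simp [latentCov, Matrix.fromCols_mul_fromBlocks, Matrix.transpose_fromCols,
      Matrix.fromCols_mul_fromRows]
  have h1 := gaussLaw_map_mulVec h (Matrix.fromCols (1 : Matrix σ σ ℝ) (0 : Matrix σ ι ℝ))
  rw [e] at h1
  rw [ofReal_gaussCDF, ← h1, Measure.map_apply (measurable_mulVec _) (measurableSet_lower γ)]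
  congr 1
  ext w
  simp [Matrix.fromCols_mulVec]

lemma measurable_affineProbit (X : ν → E) (W : Matrix α ν ℝ) (Z : α → ℝ) (S : Matrix α α ℝ) :
    Measurable fun f : E → ℝ => ENNReal.ofReal (affineProbit X W Z S f) := by
  have hm : MeasurableSet {p : (E → ℝ) × (α → ℝ) |
      ∀ k, p.2 k ≤ (Z + W *ᵥ fun j => p.1 (X j)) k} := by
    have h2 : Measurable fun f : E → ℝ => W *ᵥ fun j => f (X j) :=
      (measurable_mulVec W).comp (measurable_pi_lambda _ fun j => measurable_pi_apply (X j))
    have h3 : ∀ k, Measurable fun f : E → ℝ => (Z + W *ᵥ fun j => f (X j)) k := fun k =>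
      ((measurable_pi_apply k).comp h2).const_add (Z k)
    simp only [Set.ofPred_forall]
    exact MeasurableSet.iInter fun k => measurableSet_le
      ((measurable_pi_apply k).comp measurable_snd) ((h3 k).comp measurable_fst)
  simp only [affineProbit, ofReal_gaussCDF]
  exact measurable_measure_prodMk_left hm

lemma measurable_shift {ξ : E → ℝ} (x : ι → E) :
    Measurable fun (w : σ ⊕ ι → ℝ) i => ξ (x i) + w (.inr i) :=
  measurable_pi_lambda _ fun _ => (measurable_pi_apply _).const_add _

lemma measurable_eval_points (x : ι → E) : Measurable fun (f : E → ℝ) i => f (x i) :=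
  measurable_pi_lambda _ fun i => measurable_pi_apply (x i)

/-- The likelihood is the conditional probability, given f, of an event about independent noise, so
weighting by it amounts to adjoining the noise and restricting to that event. The points `u` carry
both the evaluation points and the data points; the constant `c` plays no role and is left
arbitrary. -/
lemma map_withDensity_affineProbit {μ : Measure (E → ℝ)} {ξ : E → ℝ} {K : E → E → ℝ}
    {Δ : E → σ → ℝ} {γ : σ → ℝ} {Γ : Matrix σ σ ℝ} {u : κ → E} {c : ℝ≥0∞}
    (hμ : μ.map (fun f i => f (u i)) =
      c • ((gaussLaw (latentCov (scaleMatrix K u) (skewMatrix Δ u) Γ)).restrict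
        {w | ∀ k, w (.inl k) ≤ γ k}).map fun w i => ξ (u i) + w (.inr i))
    (hlat : (latentCov (scaleMatrix K u) (skewMatrix Δ u) Γ).PosSemidef)
    (hpos : ∀ i, 0 < K (u i) (u i)) (W : Matrix α ν ℝ) (Z : α → ℝ)
    {S : Matrix α α ℝ} (hS : S.PosSemidef) (a : ι → κ) (b : ν → κ) :
    (μ.withDensity fun f => ENNReal.ofReal (affineProbit (u ∘ b) W Z S f)).map
        (fun f i => f ((u ∘ a) i)) =
      c • ((gaussLaw (latentCov (scaleMatrix K (u ∘ a))
          (skewMatrix (postSkew K Δ (u ∘ b) W) (u ∘ a)) (postCov K Δ Γ (u ∘ b) W S))).restrict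
        {w | ∀ k, w (.inl k) ≤ postGamma ξ γ (u ∘ b) W Z k}).map
          fun w i => ξ ((u ∘ a) i) + w (.inr i) := by
  have hsymm : ∀ i j, K (u i) (u j) = K (u j) (u i) := fun i j =>
    (by simpa [latentCov, scaleMatrix] using hlat.1.apply (.inr i) (.inr j) :
      K (u j) (u i) = K (u i) (u j)).symm
  rw [← updateMatrix_conj K Δ Γ u W S a b hpos hsymm,
    ← gaussLaw_map_mulVec (posSemidef_fromBlocks_diag hlat hS), ← gaussLaw_prod hlat hS]
  set P := gaussLaw (latentCov (scaleMatrix K u) (skewMatrix Δ u) Γ)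
  have hC := measurable_mulVec (updateMatrix σ W a b)
  ext B hB
  have hB' := (measurable_shift (σ := σ ⊕ α) (ξ := ξ) (u ∘ a)) hB
  have hT := measurableSet_latent (ι := ι) (postGamma ξ γ (u ∘ b) W Z)
  have hE := hB'.inter hT
  rw [Measure.map_apply (measurable_eval_points (u ∘ a)) hB,
    withDensity_apply _ (measurable_eval_points (u ∘ a) hB),
    Measure.smul_apply, smul_eq_mul, Measure.map_apply (measurable_shift (u ∘ a)) hB,
    Measure.restrict_apply hB', Measure.map_apply hC hE,
    Measure.map_apply measurable_sumElim (hC hE), Measure.prod_apply (measurable_sumElim (hC hE)),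
    ← lintegral_indicator (measurable_eval_points (u ∘ a) hB)]
  -- The likelihood and the event B depend on f only through its values at u, so the integral moves
  -- to the finite-dimensional marginal.
  set G : (κ → ℝ) → ℝ≥0∞ := ((fun (g : κ → ℝ) i => g (a i)) ⁻¹' B).indicator fun g =>
    ENNReal.ofReal (affineProbit b W Z S g) with hG
  have hGm : Measurable G := (measurable_affineProbit b W Z S).indicator
    ((measurable_pi_lambda _ fun i => measurable_pi_apply (a i)) hB)
  have hL : ∀ f : E → ℝ, ((fun (f : E → ℝ) i => f ((u ∘ a) i)) ⁻¹' B).indicator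
      (fun f => ENNReal.ofReal (affineProbit (u ∘ b) W Z S f)) f = G fun i => f (u i) :=
    fun f => rfl
  simp only [hL]
  rw [← lintegral_map hGm (measurable_eval_points u), hμ, lintegral_smul_measure,
    lintegral_map hGm (measurable_shift u),
    ← lintegral_indicator (measurableSet_latent γ), smul_eq_mul]
  congr 1
  refine lintegral_congr fun w => ?_
  -- For a fixed latent pair w, the event is an orthant in the noise e, once the shift W ξ(X) is
  -- moved to the other side.
  have hmem : ∀ e : α → ℝ, e ∈ Prod.mk w ⁻¹' ((fun p => Sum.elim p.1 p.2) ⁻¹'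
      ((fun z => updateMatrix σ W a b *ᵥ z) ⁻¹'
        ((fun (w : (σ ⊕ α) ⊕ ι → ℝ) i => ξ ((u ∘ a) i) + w (.inr i)) ⁻¹' B ∩
        {w | ∀ k, w (.inl k) ≤ postGamma ξ γ (u ∘ b) W Z k}))) ↔
      (fun i => ξ (u (a i)) + w (.inr (a i))) ∈ B ∧ (∀ k, w (.inl k) ≤ γ k) ∧
        ∀ k, e k ≤ (Z + W *ᵥ fun j => ξ (u (b j)) + w (.inr (b j))) k := by
    intro e
    simp only [Set.mem_preimage, Set.mem_inter_iff, Set.mem_ofPred_eq, updateMatrix_mulVec,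
      Sum.elim_inl, Sum.elim_inr, Sum.forall, postGamma, Function.comp_apply]
    refine and_congr_right' (and_congr_right' (forall_congr' fun k => ?_))
    have : (W *ᵥ fun j => ξ (u (b j)) + w (.inr (b j))) =
        (W *ᵥ fun j => ξ (u (b j))) + W *ᵥ fun j => w (.inr (b j)) := by
      rw [← Matrix.mulVec_add]
      rfl
    rw [this]
    simp only [Pi.add_apply, Pi.sub_apply]
    constructor <;> intro h <;> linarith
  by_cases h1 : ∀ k, w (.inl k) ≤ γ k
  · rw [Set.indicator_of_mem (show w ∈ {w : σ ⊕ κ → ℝ | ∀ k, w (.inl k) ≤ γ k} from h1)]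
    by_cases h2 : (fun i => ξ (u (a i)) + w (.inr (a i))) ∈ B
    · rw [hG, Set.indicator_of_mem (show (fun i => ξ (u i) + w (.inr i)) ∈
        (fun (g : κ → ℝ) i => g (a i)) ⁻¹' B from h2), affineProbit, ofReal_gaussCDF]
      congr 1
      ext e
      rw [hmem e]
      simp [h1, h2]
    · rw [hG, Set.indicator_of_notMem (show (fun i => ξ (u i) + w (.inr i)) ∉
        (fun (g : κ → ℝ) i => g (a i)) ⁻¹' B from h2)]
      refine (measure_mono_null (t := ∅) (fun e he => ?_) measure_empty).symm
      exact h2 ((hmem e).1 he).1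
  · rw [Set.indicator_of_notMem (show w ∉ {w : σ ⊕ κ → ℝ | ∀ k, w (.inl k) ≤ γ k} from h1)]
    refine (measure_mono_null (t := ∅) (fun e he => ?_) measure_empty).symm
    exact h1 ((hmem e).1 he).2.1

/-- Marginals are prescribed only at distinct points, whereas data points may repeat or coincide
with evaluation points. Enumerating the union of both families repairs this. -/
lemma exists_common_points {n : ℕ} {x : Fin n → E} (X : ν → E) :
    ∃ (N : ℕ) (u : Fin N → E) (a : Fin n → Fin N) (b : ν → Fin N),
      Function.Injective u ∧ u ∘ a = x ∧ u ∘ b = X := by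
  classical
  let s : Finset E := Finset.univ.image x ∪ Finset.univ.image X
  refine ⟨s.card, fun i => (s.equivFin.symm i : E), fun i => s.equivFin ⟨x i, by simp [s]⟩,
    fun j => s.equivFin ⟨X j, by simp [s]⟩,
    Subtype.val_injective.comp s.equivFin.symm.injective, ?_, ?_⟩ <;> ext i <;> simp

lemma scale_posDef_of_jointMatrix {Ω : Matrix ι ι ℝ} {Δ : Matrix ι σ ℝ} {Γ : Matrix σ σ ℝ}
    (h : (jointMatrix Ω Δ Γ).PosDef) : Ω.PosDef :=
  posDef_of_corr_posDef (h.submatrix (e := Sum.inr) Sum.inr_injective)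

/-! ### From a SkewGP prior to its posterior -/

section Prior

variable {μ : Measure (E → ℝ)} {ξ : E → ℝ} {K : E → E → ℝ} {Δ : E → σ → ℝ} {γ : σ → ℝ}
  {Γ : Matrix σ σ ℝ}

lemma IsSkewGP.scale_posDef (h : IsSkewGP μ ξ K Δ γ Γ) {n : ℕ} {x : Fin n → E}
    (hx : Function.Injective x) : (scaleMatrix K x).PosDef :=
  scale_posDef_of_jointMatrix (h.posDef n x hx)

lemma IsSkewGP.latentCov_posDef (h : IsSkewGP μ ξ K Δ γ Γ) {n : ℕ} {x : Fin n → E}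
    (hx : Function.Injective x) : (latentCov (scaleMatrix K x) (skewMatrix Δ x) Γ).PosDef :=
  SkewGP.latentCov_posDef (fun _ => (h.scale_posDef hx).diag_pos) (h.posDef n x hx)

/-- Positive definiteness at the empty family of points already contains that of Γ. -/
lemma IsSkewGP.normalizer_pos (h : IsSkewGP μ ξ K Δ γ Γ) : 0 < gaussCDF Γ γ :=
  gaussCDF_pos ((h.posDef 0 Fin.elim0 (Function.injective_of_subsingleton _)).submatrix
    (e := Sum.inl) Sum.inl_injective) γ

lemma IsSkewGP.marginal_eq_conditioned (h : IsSkewGP μ ξ K Δ γ Γ) {n : ℕ} {x : Fin n → E}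
    (hx : Function.Injective x) :
    μ.map (fun f i => f (x i)) = (ENNReal.ofReal (gaussCDF Γ γ))⁻¹ •
      ((gaussLaw (latentCov (scaleMatrix K x) (skewMatrix Δ x) Γ)).restrict
        {w | ∀ k, w (.inl k) ≤ γ k}).map fun w i => ξ (x i) + w (.inr i) := by
  rw [h.marginals n x hx, sunMeasure_eq_conditioned (h.scale_posDef hx)
    (h.posDef n x hx).posSemidef _ h.normalizer_pos]

/-- The marginal at no points records the total mass. -/
lemma IsSkewGP.isProbabilityMeasure (h : IsSkewGP μ ξ K Δ γ Γ) : IsProbabilityMeasure μ := by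
  have hx : Function.Injective (Fin.elim0 : Fin 0 → E) := Function.injective_of_subsingleton _
  have h1 := congrArg (fun m => m Set.univ) (h.marginal_eq_conditioned hx)
  have hp : ENNReal.ofReal (gaussCDF Γ γ) ≠ 0 := by simpa using h.normalizer_pos
  simp only [Measure.map_apply (measurable_eval_points _) MeasurableSet.univ, Set.preimage_univ,
    Measure.smul_apply, Measure.map_apply (measurable_shift _) MeasurableSet.univ,
    Measure.restrict_apply_univ, smul_eq_mul,
    gaussLaw_latentCov_lower (h.latentCov_posDef hx).posSemidef,
    ENNReal.inv_mul_cancel hp ENNReal.ofReal_ne_top] at h1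
  exact ⟨h1⟩

lemma IsSkewGP.evidence_pos (h : IsSkewGP μ ξ K Δ γ Γ) {X : ν → E} {W : Matrix α ν ℝ}
    {Z : α → ℝ} {S : Matrix α α ℝ} (hL : ∀ f, 0 < affineProbit X W Z S f) :
    0 < evidence μ (affineProbit X W Z S) := by
  have := h.isProbabilityMeasure
  rw [evidence, lintegral_pos_iff_support (measurable_affineProbit X W Z S)]
  have : (Function.support fun f => ENNReal.ofReal (affineProbit X W Z S f)) = Set.univ := by
    ext f
    simpa using hL f
  rw [this]
  simp

lemma IsSkewGP.scale_diag_pos (h : IsSkewGP μ ξ K Δ γ Γ) (x : E) : 0 < K x x :=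
  (h.scale_posDef (x := fun _ : Fin 1 => x)
    (Function.injective_of_subsingleton _)).diag_pos (i := 0)

variable (W : Matrix α ν ℝ) (Z : α → ℝ) {S : Matrix α α ℝ}

lemma IsSkewGP.latentCov_post_posSemidef (h : IsSkewGP μ ξ K Δ γ Γ) (X : ν → E)
    (hS : S.PosSemidef) {n : ℕ} (x : Fin n → E) :
    (latentCov (scaleMatrix K x) (skewMatrix (postSkew K Δ X W) x)
      (postCov K Δ Γ X W S)).PosSemidef := by
  obtain ⟨N, u, a, b, hu, rfl, rfl⟩ := exists_common_points (x := x) X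
  have hlat := h.latentCov_posDef hu
  rw [← updateMatrix_conj K Δ Γ u W S a b (fun _ => h.scale_diag_pos _)
    fun i j => by simpa [latentCov, scaleMatrix] using hlat.1.apply (.inr j) (.inr i)]
  exact posSemidef_conj (posSemidef_fromBlocks_diag hlat.posSemidef hS) _

lemma IsSkewGP.latentCov_post_posDef (h : IsSkewGP μ ξ K Δ γ Γ) (X : ν → E)
    (hS : S.PosDef) {n : ℕ} {x : Fin n → E} (hx : Function.Injective x) :
    (latentCov (scaleMatrix K x) (skewMatrix (postSkew K Δ X W) x)
      (postCov K Δ Γ X W S)).PosDef := by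
  obtain ⟨N, u, a, b, hu, rfl, rfl⟩ := exists_common_points (x := x) X
  have hlat := h.latentCov_posDef hu
  rw [← updateMatrix_conj K Δ Γ u W S a b (fun _ => h.scale_diag_pos _)
    fun i j => by simpa [latentCov, scaleMatrix] using hlat.1.apply (.inr j) (.inr i),
    ← Matrix.conjTranspose_eq_transpose_of_trivial]
  exact (posDef_fromBlocks_diag hlat hS).mul_mul_conjTranspose_same
    (updateMatrix_vecMul_injective W hx.of_comp b)

lemma IsSkewGP.map_withDensity (h : IsSkewGP μ ξ K Δ γ Γ) (X : ν → E)
    (hS : S.PosSemidef) {n : ℕ} (x : Fin n → E) :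
    (μ.withDensity fun f => ENNReal.ofReal (affineProbit X W Z S f)).map (fun f i => f (x i)) =
      (ENNReal.ofReal (gaussCDF Γ γ))⁻¹ •
        ((gaussLaw (latentCov (scaleMatrix K x) (skewMatrix (postSkew K Δ X W) x)
          (postCov K Δ Γ X W S))).restrict {w | ∀ k, w (.inl k) ≤ postGamma ξ γ X W Z k}).map
          fun w i => ξ (x i) + w (.inr i) := by
  obtain ⟨N, u, a, b, hu, rfl, rfl⟩ := exists_common_points (x := x) X
  exact map_withDensity_affineProbit (h.marginal_eq_conditioned hu)
    (h.latentCov_posDef hu).posSemidef (fun _ => h.scale_diag_pos _) W Z hS a b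

/-- The evidence is the total mass of the weighted prior, again read off the marginal at no points;
it is the ratio of the new normalizer to the old. -/
lemma IsSkewGP.evidence_eq (h : IsSkewGP μ ξ K Δ γ Γ) (X : ν → E) (hS : S.PosSemidef) :
    evidence μ (affineProbit X W Z S) = (ENNReal.ofReal (gaussCDF Γ γ))⁻¹ *
      ENNReal.ofReal (gaussCDF (postCov K Δ Γ X W S) (postGamma ξ γ X W Z)) := by
  have h1 := congrArg (fun m => m Set.univ) (h.map_withDensity W Z X hS (Fin.elim0 : Fin 0 → E))
  rw [evidence]
  simpa only [Measure.map_apply (measurable_eval_points _) MeasurableSet.univ, Set.preimage_univ,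
    Measure.smul_apply, Measure.map_apply (measurable_shift _) MeasurableSet.univ,
    Measure.restrict_apply_univ, smul_eq_mul, withDensity_apply _ MeasurableSet.univ,
    Measure.restrict_univ,
    gaussLaw_latentCov_lower (h.latentCov_post_posSemidef W X hS _)] using h1

/-- A Gaussian noise law that makes the affine probit likelihood positive turns a SkewGP prior into
a boundary SkewGP posterior. -/
theorem IsSkewGP.posterior_boundary (h : IsSkewGP μ ξ K Δ γ Γ) (X : ν → E) (hS : S.PosSemidef)
    (hL : ∀ f, 0 < affineProbit X W Z S f) :
    IsBoundarySkewGP (bayesPosterior μ (affineProbit X W Z S)) ξ K (postSkew K Δ X W)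
      (postGamma ξ γ X W Z) (postCov K Δ Γ X W S) := by
  have hγ : ENNReal.ofReal (gaussCDF Γ γ) ≠ 0 := by simpa using h.normalizer_pos
  have hev := h.evidence_eq W Z X hS
  have hpos := h.evidence_pos hL
  have hγp : 0 < gaussCDF (postCov K Δ Γ X W S) (postGamma ξ γ X W Z) := by
    rw [hev] at hpos
    exact ENNReal.ofReal_pos.1 (pos_of_mul_pos_right hpos zero_le)
  have hd : ∀ {n : ℕ} (x : Fin n → E) (i : Fin n), 0 < scaleMatrix K x i i :=
    fun x i => h.scale_diag_pos (x i)
  have hpsd : ∀ {n : ℕ} (x : Fin n → E), (jointMatrix (scaleMatrix K x)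
      (skewMatrix (postSkew K Δ X W) x) (postCov K Δ Γ X W S)).PosSemidef := fun x =>
    jointMatrix_posSemidef (hd x) (h.latentCov_post_posSemidef W X hS x)
  refine ⟨fun n x hx => h.scale_posDef hx, fun n x _ => hpsd x, hγp, fun n x hx => ?_⟩
  rw [bayesPosterior, Measure.map_smul, h.map_withDensity W Z X hS x, smul_smul,
    sunMeasure_eq_conditioned (h.scale_posDef hx) (hpsd x) _ hγp, hev]
  -- Dividing by the evidence replaces the old normalizer by the new one.
  congr 1
  rw [ENNReal.mul_inv (.inr ENNReal.ofReal_ne_top) (.inl (ENNReal.inv_ne_top.2 hγ)), inv_inv,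
    mul_comm, ← mul_assoc, ENNReal.inv_mul_cancel hγ ENNReal.ofReal_ne_top, one_mul]

/-- The affine probit likelihood turns a SkewGP prior into a SkewGP posterior. -/
theorem IsSkewGP.posterior (h : IsSkewGP μ ξ K Δ γ Γ) (X : ν → E) (hS : S.PosDef) :
    0 < evidence μ (affineProbit X W Z S) ∧
    IsSkewGP (bayesPosterior μ (affineProbit X W Z S)) ξ K (postSkew K Δ X W)
      (postGamma ξ γ X W Z) (postCov K Δ Γ X W S) := by
  have hL : ∀ f, 0 < affineProbit X W Z S f := fun f => gaussCDF_pos hS _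
  exact ⟨h.evidence_pos hL, fun n x hx => jointMatrix_posDef (fun i => h.scale_diag_pos (x i))
    (h.latentCov_post_posDef W X hS hx), (h.posterior_boundary W Z X hS.posSemidef hL).marginals⟩

end Prior

end PosteriorLaw

/-! ### Classification, preference and ordinal likelihoods as affine probits -/

section Likelihoods

variable {E ν α : Type*} [Fintype ν] [DecidableEq ν] [Fintype α] [DecidableEq α]

lemma stdNormalCDF_coe (t : ℝ) :
    stdNormalCDF (t : EReal) = (gaussianReal 0 1).real (Set.Iic t) := by
  simp only [stdNormalCDF, EReal.coe_le_coe_iff]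
  rfl

lemma gaussCDF_one (a : α → ℝ) :
    gaussCDF (1 : Matrix α α ℝ) a = ∏ k, stdNormalCDF (a k : EReal) := by
  have : {z : α → ℝ | ∀ i, z i ≤ a i} = Set.univ.pi fun i => Set.Iic (a i) := by
    ext z
    simp [Pi.le_def]
  rw [gaussCDF_eq, gaussLaw_one, this, measureReal_def, Measure.pi_pi, ENNReal.toReal_prod]
  exact Finset.prod_congr rfl fun k _ => (stdNormalCDF_coe _).symm

lemma classLik_eq_affineProbit (X : ν → E) (y : ν → ℝ) :
    classLik X y = affineProbit X (Matrix.diagonal y) 0 1 := by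
  ext f
  simp [classLik, affineProbit, gaussCDF_one, Matrix.mulVec_diagonal]

lemma prefLik_eq_affineProbit (X : ν → E) (v u : α → ν) (τ : ℝ) :
    prefLik X v u τ = affineProbit X (prefW v u τ) 0 1 := by
  ext f
  rw [affineProbit, gaussCDF_one, prefLik]
  refine Finset.prod_congr rfl fun k _ => ?_
  congr 2
  simp [prefW, Matrix.mulVec, dotProduct, sub_div, sub_mul, Finset.sum_sub_distrib, ite_div]
  ring

section Ordinal

variable {r : ℕ} {b : Fin (r + 1) → EReal} {y : ν → Fin r}

/-- The noise matrix that sends the noise of the observations to the noise of the cut points. -/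
noncomputable def ordNoise (b : Fin (r + 1) → EReal) (y : ν → Fin r) : Matrix (OrdIdx b y) ν ℝ :=
  Matrix.of fun p i => if p.obs = i then p.sign else 0

lemma ordNoise_conj : ordNoise b y * (1 : Matrix ν ν ℝ) * (ordNoise b y)ᵀ = ordS b y := by
  ext p q
  simp [ordS, ordNoise, Matrix.mul_apply, eq_comm]

lemma ordNoise_mulVec (z : ν → ℝ) (p : OrdIdx b y) :
    (ordNoise b y *ᵥ z) p = p.sign * z p.obs := by
  simp [ordNoise, Matrix.mulVec, dotProduct]

lemma ordW_mulVec (τ : ℝ) (z : ν → ℝ) (p : OrdIdx b y) :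
    (ordW b y τ *ᵥ z) p = -(p.sign / τ) * z p.obs := by
  simp [ordW, Matrix.mulVec, dotProduct]

lemma ordS_posSemidef : (ordS b y).PosSemidef := by
  rw [← ordNoise_conj]
  exact posSemidef_conj .one _

/-- An observation with a category unbounded on one side contributes at most one coordinate, so no
two coordinates share their noise. -/
lemma ordS_eq_one (h : ∀ i, b (y i).castSucc = ⊥ ∨ b (y i).succ = ⊤) : ordS b y = 1 := by
  ext p q
  rcases p with ⟨i, hi⟩ | ⟨i, hi⟩ <;> rcases q with ⟨j, hj⟩ | ⟨j, hj⟩ <;>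
    simp only [ordS, OrdIdx.obs, OrdIdx.sign, Matrix.of_apply, Sum.elim_inl, Sum.elim_inr,
      Matrix.one_apply, Sum.inl.injEq, Sum.inr.injEq, Subtype.mk.injEq, reduceCtorEq, if_false,
      mul_one, mul_neg, neg_neg]
  · rw [if_neg]
    rintro rfl
    exact (h i).elim hj hi
  · rw [if_neg]
    rintro rfl
    exact (h i).elim hi hj

/-- The difference is the mass of a half-open interval. Its lower end may be added since the
Gaussian has no atoms; the closed form is needed because the lower cut point enters the orthant as
-z ≤ -B. -/
lemma stdNormalCDF_sub_eq {A B : EReal} (h : B < A) :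
    stdNormalCDF A - stdNormalCDF B =
      (gaussianReal 0 1).real {z : ℝ | (z : EReal) ≤ A ∧ B ≤ (z : EReal)} := by
  have := nullSingletonClass_gaussianReal (μ := 0) (v := 1) one_ne_zero
  have hm : ∀ C : EReal, MeasurableSet {z : ℝ | (z : EReal) ≤ C} := fun C =>
    measurableSet_le measurable_coe_real_ereal measurable_const
  have hsub : {z : ℝ | (z : EReal) ≤ B} ⊆ {z : ℝ | (z : EReal) ≤ A} := fun z hz => le_trans hz h.le
  rw [stdNormalCDF, stdNormalCDF, ← measureReal_sdiff hsub (hm B)]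
  refine measureReal_congr ?_
  have hB : ∀ᵐ z : ℝ ∂gaussianReal 0 1, (z : EReal) ≠ B := by
    induction B with
    | bot => exact .of_forall fun z => EReal.coe_ne_bot z
    | top => exact .of_forall fun z => EReal.coe_ne_top z
    | coe x =>
      filter_upwards [Measure.ae_ne (gaussianReal 0 1) x] with z hz
      exact_mod_cast hz
  filter_upwards [hB] with z hz
  refine propext (and_congr_right fun _ => ?_)
  exact not_le.trans ⟨le_of_lt, fun h => lt_of_le_of_ne h hz.symm⟩

lemma stdNormalCDF_lt {A B : EReal} (h : B < A) : stdNormalCDF B < stdNormalCDF A := by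
  rw [← sub_pos, stdNormalCDF_sub_eq h, measureReal_def, ENNReal.toReal_pos_iff]
  refine ⟨pos_iff_ne_zero.2 fun h0 => ?_, measure_lt_top _ _⟩
  obtain ⟨p, hp, hpA⟩ := EReal.lt_iff_exists_real_btwn.1 h
  obtain ⟨q, hq, hqA⟩ := EReal.lt_iff_exists_real_btwn.1 hpA
  have hpq : p < q := by exact_mod_cast hq
  have h1 := gaussianReal_absolutelyContinuous' 0 one_ne_zero h0
  have hsub : Set.Ioo p q ⊆ {z : ℝ | (z : EReal) ≤ A ∧ B ≤ (z : EReal)} := fun z hz =>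
    ⟨(lt_trans (EReal.coe_lt_coe_iff.2 hz.2) hqA).le,
      (lt_trans hp (EReal.coe_lt_coe_iff.2 hz.1)).le⟩
  have h2 : volume (Set.Ioo p q) = 0 := measure_mono_null hsub h1
  simp only [Real.volume_Ioo, ENNReal.ofReal_eq_zero] at h2
  linarith

lemma strictMono_sub_div (t : ℝ) {τ : ℝ} (hτ : 0 < τ) :
    StrictMono fun x : EReal => (x - (t : EReal)) / (τ : EReal) := by
  have h1 := EReal.strictMono_div_right_of_pos (b := τ) (by exact_mod_cast hτ) (EReal.coe_ne_top τ)
  exact fun x x' h => h1 (EReal.sub_lt_sub_of_lt_of_le h le_rfl (EReal.coe_ne_bot t)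
    (EReal.coe_ne_top t))

/-- An infinite cut point imposes no condition, which is why `OrdIdx` has coordinates for finite
ones only. -/
lemma coe_le_sub_div_iff {x : EReal} (hx : x ≠ ⊥) {t τ : ℝ} (hτ : 0 < τ) (z : ℝ) :
    (z : EReal) ≤ (x - (t : EReal)) / (τ : EReal) ↔ (x ≠ ⊤ → z ≤ (x.toReal - t) / τ) := by
  induction x with
  | bot => exact absurd rfl hx
  | top =>
    rw [EReal.top_sub_coe, EReal.top_div_of_pos_ne_top (by exact_mod_cast hτ) (EReal.coe_ne_top τ)]
    simp
  | coe x =>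
    simp only [ne_eq, EReal.coe_ne_top, not_false_eq_true, forall_const, EReal.toReal_coe]
    rw [← EReal.coe_sub, ← EReal.coe_div, EReal.coe_le_coe_iff]

lemma sub_div_le_coe_iff {x : EReal} (hx : x ≠ ⊤) {t τ : ℝ} (hτ : 0 < τ) (z : ℝ) :
    (x - (t : EReal)) / (τ : EReal) ≤ (z : EReal) ↔ (x ≠ ⊥ → (x.toReal - t) / τ ≤ z) := by
  induction x with
  | top => exact absurd rfl hx
  | bot =>
    rw [EReal.bot_sub, EReal.bot_div_of_pos_ne_top (by exact_mod_cast hτ) (EReal.coe_ne_top τ)]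
    simp
  | coe x =>
    simp only [ne_eq, EReal.coe_ne_bot, not_false_eq_true, forall_const, EReal.toReal_coe]
    rw [← EReal.coe_sub, ← EReal.coe_div, EReal.coe_le_coe_iff]

lemma ordLik_pos (X : ν → E) (hb : StrictMono b) {τ : ℝ} (hτ : 0 < τ) (f : E → ℝ) :
    0 < ordLik X b y τ f :=
  Finset.prod_pos fun i _ => sub_pos.2 <| stdNormalCDF_lt <|
    strictMono_sub_div (f (X i)) hτ (hb (Fin.castSucc_lt_succ (i := y i)))

/-- With one standard normal variable per observation, carried to the cut points by `ordNoise`, the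
orthant pulls back to a product of intervals, and independence turns its probability into the
product of differences. -/
lemma ordLik_eq_affineProbit (X : ν → E) (hb : StrictMono b) {τ : ℝ} (hτ : 0 < τ) :
    ordLik X b y τ = affineProbit X (ordW b y τ) (ordZ b y τ) (ordS b y) := by
  ext f
  have hlt : ∀ i, b (y i).castSucc < b (y i).succ := fun i => hb Fin.castSucc_lt_succ
  rw [affineProbit, gaussCDF_eq, ← ordNoise_conj, ← gaussLaw_map_mulVec .one, gaussLaw_one,
    measureReal_def, Measure.map_apply (measurable_mulVec _) (measurableSet_lower _)]
  have hset : (fun z => ordNoise b y *ᵥ z) ⁻¹' {z | ∀ p, z p ≤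
      (ordZ b y τ + ordW b y τ *ᵥ fun j => f (X j)) p} =
      Set.univ.pi fun i => {z : ℝ | (z : EReal) ≤ (b (y i).succ - (f (X i) : EReal)) / (τ : EReal) ∧
        (b (y i).castSucc - (f (X i) : EReal)) / (τ : EReal) ≤ (z : EReal)} := by
    ext z
    simp only [Set.mem_preimage, Set.mem_ofPred_eq, Set.mem_univ_pi, Pi.add_apply, ordNoise_mulVec,
      ordW_mulVec, coe_le_sub_div_iff (ne_bot_of_gt (hlt _)) hτ,
      sub_div_le_coe_iff (ne_top_of_lt (hlt _)) hτ, forall_and, Sum.forall, ordZ, OrdIdx.obs,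
      OrdIdx.sign, OrdIdx.cut, Sum.elim_inl, Sum.elim_inr, Subtype.forall]
    refine and_congr (forall₂_congr fun i _ => ?_) (forall₂_congr fun i _ => ?_)
    · rw [show 1 * (b (y i).succ).toReal / τ + -(1 / τ) * f (X i) =
        ((b (y i).succ).toReal - f (X i)) / τ by ring, one_mul]
    · rw [show -1 * (b (y i).castSucc).toReal / τ + -(-1 / τ) * f (X i) =
        -(((b (y i).castSucc).toReal - f (X i)) / τ) by ring, neg_one_mul, neg_le_neg_iff]
  rw [hset, Measure.pi_pi, ENNReal.toReal_prod, ordLik]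
  exact Finset.prod_congr rfl fun i _ => stdNormalCDF_sub_eq (strictMono_sub_div _ hτ (hlt i))

end Ordinal

end Likelihoods

end SkewGP

theorem theorem2 {d : ℕ} {σ ν α : Type*} [Fintype σ] [DecidableEq σ] [Fintype ν] [DecidableEq ν]
    [Fintype α] [DecidableEq α]
    (μ : MeasureTheory.Measure (EuclideanSpace ℝ (Fin d) → ℝ))
    (ξ : EuclideanSpace ℝ (Fin d) → ℝ)
    (K : EuclideanSpace ℝ (Fin d) → EuclideanSpace ℝ (Fin d) → ℝ)
    (Δ : EuclideanSpace ℝ (Fin d) → σ → ℝ) (γ : σ → ℝ) (Γ : Matrix σ σ ℝ)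
    (hprior : SkewGP.IsSkewGP μ ξ K Δ γ Γ)
    (X : ν → EuclideanSpace ℝ (Fin d)) :
    -- the affine probit likelihood
    (∀ (W : Matrix α ν ℝ) (Z : α → ℝ) (S : Matrix α α ℝ), S.PosDef →
      0 < SkewGP.evidence μ (SkewGP.affineProbit X W Z S) ∧
      SkewGP.IsSkewGP (SkewGP.bayesPosterior μ (SkewGP.affineProbit X W Z S))
        ξ K (SkewGP.postSkew K Δ X W) (SkewGP.postGamma ξ γ X W Z)
        (SkewGP.postCov K Δ Γ X W S)) ∧
    -- the classification likelihood
    (∀ y : ν → ℝ, (∀ i, y i = 1 ∨ y i = -1) →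
      SkewGP.IsSkewGP (SkewGP.bayesPosterior μ (SkewGP.classLik X y))
        ξ K (SkewGP.postSkew K Δ X (Matrix.diagonal y))
        (SkewGP.postGamma ξ γ X (Matrix.diagonal y) 0)
        (SkewGP.postCov K Δ Γ X (Matrix.diagonal y) 1)) ∧
    -- the preference likelihood
    (∀ (v u : α → ν) (τ : ℝ), 0 < τ →
      SkewGP.IsSkewGP (SkewGP.bayesPosterior μ (SkewGP.prefLik X v u τ))
        ξ K (SkewGP.postSkew K Δ X (SkewGP.prefW v u τ))
        (SkewGP.postGamma ξ γ X (SkewGP.prefW v u τ) 0)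
        (SkewGP.postCov K Δ Γ X (SkewGP.prefW v u τ) 1)) ∧
    -- the ordinal likelihood
    (∀ (r : ℕ) (b : Fin (r + 1) → EReal) (y : ν → Fin r) (τ : ℝ),
      StrictMono b → b 0 = ⊥ → b (Fin.last r) = ⊤ → 0 < τ →
      SkewGP.IsBoundarySkewGP (SkewGP.bayesPosterior μ (SkewGP.ordLik X b y τ))
        ξ K (SkewGP.postSkew K Δ X (SkewGP.ordW b y τ))
        (SkewGP.postGamma ξ γ X (SkewGP.ordW b y τ) (SkewGP.ordZ b y τ))
        (SkewGP.postCov K Δ Γ X (SkewGP.ordW b y τ) (SkewGP.ordS b y)) ∧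
      ((∀ i, b (y i).castSucc = ⊥ ∨ b (y i).succ = ⊤) →
        SkewGP.IsSkewGP (SkewGP.bayesPosterior μ (SkewGP.ordLik X b y τ))
          ξ K (SkewGP.postSkew K Δ X (SkewGP.ordW b y τ))
          (SkewGP.postGamma ξ γ X (SkewGP.ordW b y τ) (SkewGP.ordZ b y τ))
          (SkewGP.postCov K Δ Γ X (SkewGP.ordW b y τ) (SkewGP.ordS b y)))) := by
  refine ⟨fun W Z S hS => hprior.posterior W Z X hS, fun y _ => ?_, fun v u τ _ => ?_,
    fun r b y τ hb _ _ hτ => ⟨?_, fun h => ?_⟩⟩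
  · rw [SkewGP.classLik_eq_affineProbit]
    exact (hprior.posterior _ _ X .one).2
  · rw [SkewGP.prefLik_eq_affineProbit]
    exact (hprior.posterior _ _ X .one).2
  · have hL := SkewGP.ordLik_eq_affineProbit (y := y) X hb hτ
    rw [hL]
    -- The noise may be singular, so positivity of the likelihood comes from the strictly increasing
    -- cut points instead of `gaussCDF_pos`.
    exact hprior.posterior_boundary _ _ X SkewGP.ordS_posSemidef
      fun f => hL ▸ SkewGP.ordLik_pos X hb hτ f
  · rw [SkewGP.ordLik_eq_affineProbit X hb hτ]
    exact (hprior.posterior _ _ X (by rw [SkewGP.ordS_eq_one h]; exact .one)).2
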